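/- Let $R>0$ and $0<\lambda,\nu<1$, and put $F(\xi)=1-\lambda\xi$, $G(\xi)=(1-\xi^2)(1-\nu\xi)$. The five-dimensional black ring metric, in coordinates $(x,y,\phi,\psi,t)$, is $$g=-\frac{F(x)}{F(y)}\bigl(dt+R\sqrt{\lambda\nu}\,(1+y)\,d\psi\bigr)^2+\frac{R^2}{(x-y)^2}\Bigl[-F(x)\Bigl(G(y)\,d\psi^2+\frac{F(y)}{G(y)}\,dy^2\Bigr)+F(y)^2\Bigl(\frac{dx^2}{G(x)}+\frac{G(x)}{F(x)}\,d\phi^2\Bigr)\Bigr],$$ considered on the regions $\mathcal A=\{-1<x<1,\ y<-1\}$ and $\mathcal B=\{-1<x<1,\ 1/\lambda<y<1/\nu\}$ of $\mathbb R^5$ ($\mathcal B$ is nonempty if and only if $\nu<\lambda$). With principal square roots let $$\theta^1,\tilde\theta^1=\frac{R\sqrt{-F(x)G(y)}}{\sqrt2\,(x-y)}\Bigl(\frac{\sqrt{F(y)}}{G(y)}\,dy\pm i\,d\psi\Bigr),\quad \theta^2,\tilde\theta^2=\frac{RF(y)\sqrt{G(x)}}{\sqrt2\,(x-y)\sqrt{F(x)}}\Bigl(\frac{\sqrt{F(x)}}{G(x)}\,dx\pm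 i\,d\phi\Bigr),$$ $$e^0=\sqrt{-\tfrac{F(x)}{F(y)}}\,\bigl(dt+R\sqrt{\lambda\nu}\,(1+y)\,d\psi\bigr),$$ with dual frame $\theta_1,\tilde\theta_1,\theta_2,\tilde\theta_2,e_0$, and set $N_0=\mathrm{span}\{\tilde\theta_1,\tilde\theta_2\}$, $N_1=\mathrm{span}\{\theta_1,\tilde\theta_2\}$, $N_2=\mathrm{span}\{\tilde\theta_1,\theta_2\}$, $N_{12}=\mathrm{span}\{\theta_1,\theta_2\}$. An almost null structure in dimension five is a smooth rank-2 complex subbundle $N$ of the complexified tangent bundle with $N\subset N^\perp$; its real index at a point is $\dim_{\mathbb C}(N\cap\overline N)$. An optical structure $(N,K)$ is an almost null structure $N$ of real index 1, with the real null line bundle $K$ given by $N\cap\overline N=\mathbb C\otimes K$, such that $N$ and $N^\perp$ are integrable in the sense of Frobenius. A CR structure is an integrable complex subbundle $N$ of the complexified tangent bundle with $N\cap\overline N=0$. The Weyl tensor $C$ is algebraically special relative to $N$ at a point if $C(X,Y,Z,\cdot)=0$ there for all $X,Y\in N^\perp$ and $Z\in N$. Then: 1. $g$ is Lorentzian and Ricci-flat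 on $\mathcal A$ and on $\mathcal B$. There the above $1$-forms form a basis and $g=2\,\theta^1\odot\tilde\theta^1+2\,\theta^2\odot\tilde\theta^2+e^0\otimes e^0$. 2. On $\mathcal B$, $\overline{N_1}=N_{12}$ and $\overline{N_0}=N_2$. Moreover $N_0$ and $N_1$ have real index 1 and, with the line bundles of their real vectors, are two optical structures; at every point the two distributions are distinct and so are their real lines. 3. On $\mathcal A$, $\overline{N_1}=N_2$ and $\overline{N_0}=N_{12}$. Moreover $N_0$ and $N_1$ are almost null structures of real index 0, they and their orthogonal complements are integrable, and they define two CR structures; at every point $N_0$ differs from $N_1$ and from $\overline{N_1}$. 4. At no point of $\mathcal A$ or $\mathcal B$ is the Weyl tensor of $g$ algebraically special relative to any of $N_0,N_1,N_2,N_{12}$. 5. The converse of the five-dimensional Goldberg–Sachs theorem fails, even in vacuum. With $P$ the Rho (Schouten) tensor and $A_{abc}=\nabla_bP_{ca}-\nabla_cP_{ba}$ the Cotton–York tensor, it is not true that, for every Ricci-flat Lorentzian metric on an open subset of $\mathbb R^5$ and every optical structure $(N,K)$ on it such that $A(Z,X,Y)=0$ for all $X,Y\in N^\perp$ and $Z\in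 N$, the Weyl tensor is algebraically special relative to $N$ at every point. -/

import Mathlib

open scoped ContDiff

noncomputable section

namespace BlackRing

/-! Five-dimensional Lorentzian geometry on open subsets of `ℝ⁵`, in coordinates. -/

/-- Points of the coordinate space, and real tangent vectors in coordinates. -/
abbrev Pt : Type := Fin 5 → ℝ

/-- Complexified tangent vectors in coordinates. -/
abbrev CVec : Type := Fin 5 → ℂ

/-- The partial derivative `∂ᵢ f` at `p`. -/
def pd {E : Type*} [NormedAddCommGroup E] [NormedSpace ℝ E] (i : Fin 5) (f : Pt → E) (p : Pt) : E :=
  fderiv ℝ f p (Pi.single i 1)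

/-- A smooth Lorentzian metric, of signature `(-,+,+,+,+)`, on `U`. -/
structure IsLorentzian (U : Set Pt) (g : Pt → Matrix (Fin 5) (Fin 5) ℝ) : Prop where
  smooth : ∀ i j, ContDiffOn ℝ ∞ (fun p => g p i j) U
  symm : ∀ p ∈ U, (g p).IsSymm
  signature : ∀ p ∈ U, ∃ P : Matrix (Fin 5) (Fin 5) ℝ,
    IsUnit P.det ∧ P.transpose * g p * P = Matrix.diagonal ![-1, 1, 1, 1, 1]

section Curvature

variable (g : Pt → Matrix (Fin 5) (Fin 5) ℝ)

/-- Christoffel symbols `Γᵏᵢⱼ` of the Levi-Civita connection. -/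
def christoffel (k i j : Fin 5) (p : Pt) : ℝ :=
  (1 / 2) * ∑ l, (g p)⁻¹ k l *
    (pd i (fun q => g q j l) p + pd j (fun q => g q i l) p - pd l (fun q => g q i j) p)

/-- The components `R_{abc}^d`, where `(∇_a ∇_b - ∇_b ∇_a) V^d = R_{abc}^d V^c`. -/
def riemannUp (a b c d : Fin 5) (p : Pt) : ℝ :=
  pd a (christoffel g d b c) p - pd b (christoffel g d a c) p
    + ∑ e, (christoffel g d a e p * christoffel g e b c p
      - christoffel g d b e p * christoffel g e a c p)

/-- `R_{abcd}`, the last index being lowered. -/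
def riemann (a b c d : Fin 5) (p : Pt) : ℝ := ∑ e, riemannUp g a b c e p * g p e d

/-- The Ricci tensor `R_{abc}^a`. -/
def ricci (b c : Fin 5) (p : Pt) : ℝ := ∑ a, riemannUp g a b c a p

/-- The scalar curvature. -/
def scalarCurv (p : Pt) : ℝ := ∑ b, ∑ c, (g p)⁻¹ b c * ricci g b c p

/-- The Rho (Schouten) tensor `(Ric - S g / (2 (n - 1))) / (n - 2)` in dimension `n = 5`. -/
def rho (a b : Fin 5) (p : Pt) : ℝ := (1 / 3) * (ricci g a b p - scalarCurv g p / 8 * g p a b)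

/-- The Weyl tensor `C_{abcd}`, defined by `R_{abcd} = C_{abcd} - 4 g_{[a|[c} P_{d]|b]}`
with `P` the Rho tensor. -/
def weyl (a b c d : Fin 5) (p : Pt) : ℝ :=
  riemann g a b c d p
    + (g p a c * rho g d b p - g p a d * rho g c b p
      - g p b c * rho g d a p + g p b d * rho g c a p)

/-- The covariant derivative `∇_b P_{ca}` of the Rho tensor. -/
def covRho (b c a : Fin 5) (p : Pt) : ℝ :=
  pd b (rho g c a) p
    - ∑ e, (christoffel g e b c p * rho g e a p + christoffel g e b a p * rho g c e p)

/-- The Cotton-York tensor `A_{abc} = ∇_b P_{ca} - ∇_c P_{ba}`. -/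
def cottonYork (a b c : Fin 5) (p : Pt) : ℝ := covRho g b c a p - covRho g c b a p

/-- The vacuum equation. -/
def IsRicciFlat (U : Set Pt) : Prop := ∀ p ∈ U, ∀ a b, ricci g a b p = 0

/-- The complex multilinear extension of the Weyl tensor at `p`. -/
def weylC (p : Pt) (X Y Z W : CVec) : ℂ :=
  ∑ a, ∑ b, ∑ c, ∑ d, (weyl g a b c d p : ℂ) * X a * Y b * Z c * W d

/-- The complex multilinear extension of the Cotton-York tensor at `p`. -/
def cottonYorkC (p : Pt) (Z X Y : CVec) : ℂ :=
  ∑ a, ∑ b, ∑ c, (cottonYork g a b c p : ℂ) * Z a * X b * Y c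

/-- The complex bilinear extension of the metric at `p`. -/
def metricC (p : Pt) (X Y : CVec) : ℂ := ∑ i, ∑ j, (g p i j : ℂ) * X i * Y j

/-- The orthogonal complement `N^⊥` for the complexified metric. -/
def orthC (N : Pt → Submodule ℂ CVec) (p : Pt) : Submodule ℂ CVec where
  carrier := {X | ∀ Y ∈ N p, metricC g p X Y = 0}
  add_mem' := by
    intro X X' hX hX' Y hY
    have h1 := hX Y hY
    have h2 := hX' Y hY
    simp only [metricC] at h1 h2 ⊢
    simp only [Pi.add_apply, mul_add, add_mul, Finset.sum_add_distrib, h1, h2, add_zero]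
  zero_mem' := by
    intro Y _
    simp [metricC]
  smul_mem' := by
    intro c X hX Y hY
    have h1 := hX Y hY
    simp only [metricC] at h1 ⊢
    have h2 : ∑ i, ∑ j, (g p i j : ℂ) * (c • X) i * Y j
        = c * ∑ i, ∑ j, (g p i j : ℂ) * X i * Y j := by
      simp only [Finset.mul_sum, Pi.smul_apply, smul_eq_mul]
      refine Finset.sum_congr rfl fun i _ => Finset.sum_congr rfl fun j _ => ?_
      ring
    rw [h2, h1, mul_zero]

end Curvature

/-! Distributions, null structures and optical structures. -/

/-- `N` is a smooth subbundle of rank `r`, real or complex, of the trivial bundle over `U`: near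
each point of `U` it has a smooth frame of `r` sections. -/
def IsSmoothSubbundle {𝕜 : Type*} [NormedField 𝕜] [NormedSpace ℝ 𝕜] (U : Set Pt)
    (N : Pt → Submodule 𝕜 (Fin 5 → 𝕜)) (r : ℕ) : Prop :=
  ∀ p ∈ U, ∃ V : Set Pt, IsOpen V ∧ p ∈ V ∧ V ⊆ U ∧ ∃ s : Fin r → Pt → (Fin 5 → 𝕜),
    (∀ a, ContDiffOn ℝ ∞ (s a) V) ∧
    ∀ q ∈ V, LinearIndependent 𝕜 (fun a => s a q) ∧
      Submodule.span 𝕜 (Set.range fun a => s a q) = N q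

/-- The Lie bracket of complex vector fields. -/
def bracketC (X Y : Pt → CVec) (p : Pt) : CVec := fun k =>
  ∑ i, (X p i * pd i (fun q => Y q k) p - Y p i * pd i (fun q => X q k) p)

/-- Integrability in the sense of Frobenius: `[Γ(N), Γ(N)] ⊆ Γ(N)` over `U`. -/
def IsIntegrable (U : Set Pt) (N : Pt → Submodule ℂ CVec) : Prop :=
  ∀ X Y : Pt → CVec, ContDiffOn ℝ ∞ X U → ContDiffOn ℝ ∞ Y U →
    (∀ p ∈ U, X p ∈ N p) → (∀ p ∈ U, Y p ∈ N p) → ∀ p ∈ U, bracketC X Y p ∈ N p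

/-- The complex conjugate of a complex subspace. -/
def conjSub (S : Submodule ℂ CVec) : Submodule ℂ CVec where
  carrier := {v | star v ∈ S}
  add_mem' := by
    intro v w hv hw
    simp only [Set.mem_ofPred_eq, star_add] at hv hw ⊢
    exact S.add_mem hv hw
  zero_mem' := by simp
  smul_mem' := by
    intro c v hv
    simp only [Set.mem_ofPred_eq, star_smul] at hv ⊢
    exact S.smul_mem _ hv

/-- A real vector as a complex vector. -/
def toC (v : Pt) : CVec := fun i => (v i : ℂ)

/-- The complexification `ℂ ⊗ S` of a real subspace, inside the complexified tangent space. -/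
def complexify (S : Submodule ℝ Pt) : Submodule ℂ CVec := Submodule.span ℂ (toC '' (S : Set Pt))

/-- The space of the real vectors in a complex subspace. -/
def realPoints (S : Submodule ℂ CVec) : Submodule ℝ Pt where
  carrier := {v | toC v ∈ S}
  add_mem' := by
    intro v w hv hw
    have h : toC (v + w) = toC v + toC w := by
      funext i
      simp [toC]
    simp only [Set.mem_ofPred_eq] at hv hw ⊢
    rw [h]
    exact S.add_mem hv hw
  zero_mem' := by
    have h : toC 0 = 0 := by
      funext i
      simp [toC]
    simp only [Set.mem_ofPred_eq, h]
    exact S.zero_mem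
  smul_mem' := by
    intro c v hv
    have h : toC (c • v) = (c : ℂ) • toC v := by
      funext i
      simp [toC]
    simp only [Set.mem_ofPred_eq] at hv ⊢
    rw [h]
    exact S.smul_mem _ hv

/-- The real index of `N` at `p`. -/
def realIndex (N : Pt → Submodule ℂ CVec) (p : Pt) : ℕ :=
  Module.finrank ℂ (N p ⊓ conjSub (N p) : Submodule ℂ CVec)

/-- An almost null structure in dimension five: a totally null complex subbundle of the maximal
rank `2`. -/
structure IsAlmostNull (U : Set Pt) (g : Pt → Matrix (Fin 5) (Fin 5) ℝ)
    (N : Pt → Submodule ℂ CVec) : Prop where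
  subbundle : IsSmoothSubbundle U N 2
  null : ∀ p ∈ U, N p ≤ orthC g N p

/-- An almost optical structure `(N, K)`: an almost null structure of real index `1`, with the
real null line bundle `K` given by `N ∩ N̄ = ℂ ⊗ K`. -/
structure IsAlmostOptical (U : Set Pt) (g : Pt → Matrix (Fin 5) (Fin 5) ℝ)
    (N : Pt → Submodule ℂ CVec) (K : Pt → Submodule ℝ Pt) : Prop where
  almostNull : IsAlmostNull U g N
  realIndex_eq : ∀ p ∈ U, realIndex N p = 1
  lineBundle : IsSmoothSubbundle U K 1
  line_null : ∀ p ∈ U, ∀ v ∈ K p, ∑ i, ∑ j, g p i j * v i * v j = 0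
  inter_eq : ∀ p ∈ U, N p ⊓ conjSub (N p) = complexify (K p)

/-- An optical structure: an almost optical structure with `N` and `N^⊥` integrable. -/
structure IsOptical (U : Set Pt) (g : Pt → Matrix (Fin 5) (Fin 5) ℝ)
    (N : Pt → Submodule ℂ CVec) (K : Pt → Submodule ℝ Pt) : Prop where
  almostOptical : IsAlmostOptical U g N K
  integrable : IsIntegrable U N
  integrable_orth : IsIntegrable U (orthC g N)

/-- A CR structure of CR dimension `r`: an integrable complex subbundle of rank `r` of the
complexified tangent bundle that meets its conjugate trivially. -/
structure IsCRStructure (U : Set Pt) (N : Pt → Submodule ℂ CVec) (r : ℕ) : Prop where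
  subbundle : IsSmoothSubbundle U N r
  inter_eq : ∀ p ∈ U, N p ⊓ conjSub (N p) = ⊥
  integrable : IsIntegrable U N

/-- The condition `C(X, Y, Z, ·) = 0` for `X, Y ∈ N^⊥` and `Z ∈ N`, at the point `p`. -/
def WeylSpecialAt (g : Pt → Matrix (Fin 5) (Fin 5) ℝ) (N : Pt → Submodule ℂ CVec) (p : Pt) : Prop :=
  ∀ X ∈ orthC g N p, ∀ Y ∈ orthC g N p, ∀ Z ∈ N p, ∀ W : CVec, weylC g p X Y Z W = 0

/-- The Weyl tensor is algebraically special relative to `N` on `U`. -/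
def IsWeylSpecial (U : Set Pt) (g : Pt → Matrix (Fin 5) (Fin 5) ℝ)
    (N : Pt → Submodule ℂ CVec) : Prop := ∀ p ∈ U, WeylSpecialAt g N p

/-- The condition `A(Z, X, Y) = 0` for `X, Y ∈ N^⊥` and `Z ∈ N`. -/
def IsCottonYorkDegenerate (U : Set Pt) (g : Pt → Matrix (Fin 5) (Fin 5) ℝ)
    (N : Pt → Submodule ℂ CVec) : Prop :=
  ∀ p ∈ U, ∀ X ∈ orthC g N p, ∀ Y ∈ orthC g N p, ∀ Z ∈ N p, cottonYorkC g p Z X Y = 0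

/-- The converse of the five-dimensional Lorentzian Goldberg-Sachs theorem (which says that if the
Weyl tensor is generically algebraically special relative to an almost optical structure and the
Cotton-York tensor is degenerate on it, then the structure is integrable), for vacuum spacetimes. -/
def GoldbergSachsConverse : Prop :=
  ∀ (U : Set Pt) (g : Pt → Matrix (Fin 5) (Fin 5) ℝ) (N : Pt → Submodule ℂ CVec)
    (K : Pt → Submodule ℝ Pt),
    IsOpen U → IsLorentzian U g → IsRicciFlat g U → IsCottonYorkDegenerate U g N →
      IsOptical U g N K → IsWeylSpecial U g N

/-! The black ring, in the coordinates `(x, y, φ, ψ, t) = (p 0, p 1, p 2, p 3, p 4)`. -/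

/-- The function `F(ξ) = 1 - λ ξ`. -/
def ringF (lam ξ : ℝ) : ℝ := 1 - lam * ξ

/-- The function `G(ξ) = (1 - ξ²) (1 - ν ξ)`. -/
def ringG (nu ξ : ℝ) : ℝ := (1 - ξ ^ 2) * (1 - nu * ξ)

/-- The region `-1 < x < 1`, `y < -1`. -/
def regionA : Set Pt := {p | -1 < p 0 ∧ p 0 < 1 ∧ p 1 < -1}

/-- The region `-1 < x < 1`, `1/λ < y < 1/ν`. -/
def regionB (lam nu : ℝ) : Set Pt := {p | -1 < p 0 ∧ p 0 < 1 ∧ 1 / lam < p 1 ∧ p 1 < 1 / nu}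

/-- The black ring metric
`-F(x)/F(y) (dt + R √(λν) (1 + y) dψ)² + R²/(x-y)² (-F(x) (G(y) dψ² + F(y)/G(y) dy²)
  + F(y)² (dx²/G(x) + G(x)/F(x) dφ²))`. -/
def ringMetric (R lam nu : ℝ) (p : Pt) : Matrix (Fin 5) (Fin 5) ℝ :=
  let x := p 0
  let y := p 1
  let F := ringF lam
  let G := ringG nu
  let W := R ^ 2 / (x - y) ^ 2
  let c := R * √(lam * nu) * (1 + y)
  !![W * F y ^ 2 / G x, 0, 0, 0, 0;
     0, -(W * F x * F y / G y), 0, 0, 0;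
     0, 0, W * F y ^ 2 * G x / F x, 0, 0;
     0, 0, 0, -(W * F x * G y) - F x / F y * c ^ 2, -(F x / F y * c);
     0, 0, 0, -(F x / F y * c), -(F x / F y)]

/-- The principal complex square root of a real number: `√r` for `r ≥ 0` and `i √(-r)` for
`r ≤ 0` (in either case the other summand is zero, the real square root of a negative number
being `0` in Mathlib). -/
def csqrt (r : ℝ) : ℂ := (√r : ℂ) + Complex.I * (√(-r) : ℂ)

/-- The basis `1`-forms `θ¹, θ̃¹, θ², θ̃², e⁰`, in this order, as the rows of a matrix. -/
def ringCoframe (R lam nu : ℝ) (p : Pt) : Matrix (Fin 5) (Fin 5) ℂ :=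
  let x := p 0
  let y := p 1
  let F := ringF lam
  let G := ringG nu
  let a₁ : ℂ := R * csqrt (-(F x * G y)) / ((√2 : ℝ) * (x - y))
  let b₁ : ℂ := csqrt (F y) / G y
  let a₂ : ℂ := R * F y * csqrt (G x) / ((√2 : ℝ) * (x - y) * csqrt (F x))
  let b₂ : ℂ := csqrt (F x) / G x
  let a₀ : ℂ := csqrt (-(F x / F y))
  !![0, a₁ * b₁, 0, a₁ * Complex.I, 0;
     0, a₁ * b₁, 0, -(a₁ * Complex.I), 0;
     a₂ * b₂, 0, a₂ * Complex.I, 0, 0;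
     a₂ * b₂, 0, -(a₂ * Complex.I), 0, 0;
     0, 0, 0, a₀ * (R * (√(lam * nu) : ℝ) * (1 + y)), a₀]

/-- The dual basis of vector fields `θ₁, θ̃₁, θ₂, θ̃₂, e₀`, numbered from `0` to `4`: the columns of
the inverse of the coframe matrix. -/
def ringFrame (R lam nu : ℝ) (a : Fin 5) (p : Pt) : CVec :=
  fun i => (ringCoframe R lam nu p)⁻¹ i a

/-- The distribution `N₀ = span {θ̃₁, θ̃₂}`. -/
def ringN0 (R lam nu : ℝ) (p : Pt) : Submodule ℂ CVec :=
  Submodule.span ℂ {ringFrame R lam nu 1 p, ringFrame R lam nu 3 p}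

/-- The distribution `N₁ = span {θ₁, θ̃₂}`. -/
def ringN1 (R lam nu : ℝ) (p : Pt) : Submodule ℂ CVec :=
  Submodule.span ℂ {ringFrame R lam nu 0 p, ringFrame R lam nu 3 p}

/-- The distribution `N₂ = span {θ̃₁, θ₂}`. -/
def ringN2 (R lam nu : ℝ) (p : Pt) : Submodule ℂ CVec :=
  Submodule.span ℂ {ringFrame R lam nu 1 p, ringFrame R lam nu 2 p}

/-- The distribution `N₁₂ = span {θ₁, θ₂}`. -/
def ringN12 (R lam nu : ℝ) (p : Pt) : Submodule ℂ CVec :=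
  Submodule.span ℂ {ringFrame R lam nu 0 p, ringFrame R lam nu 2 p}

end BlackRing

end

noncomputable section

namespace BlackRing

/-! Completing the square, the metric is `a dx² + b dy² + c dφ² + d dψ² - f (dt + w dψ)²`, with
coefficients depending on `x, y` only and `w` affine in `y`. For every metric of this shape
(`BlockData`) the Christoffel symbols and the needed curvature components are computed once, in
terms of logarithmic derivatives of the coefficients. Substituting those of the black ring turns
Ricci-flatness (`ricci_ring`) into rational identities in `x, y, λ, ν`.

The null structures are best described by equations rather than frames. Each of the four
distributions is `X² = k₂ X⁰`, `X³ = k₁ X¹`, `X⁴ = -w X³`, where `k₁ = ± i √F(y) / G(y)` and `k₂ = ±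
i √F(x) / G(x)`; the four sign choices give the four structures. The orthogonal complement is
obtained by dropping the last equation (`HasEqs.orth`), because `b = -d k₁²` and `a = -c k₂²`.
Integrability of both holds because `k₁` and `w` depend on `y` alone and `k₂` on `x` alone
(`NullData.bracket_eqs`, `HasEqs.isIntegrable`).

Complex conjugation replaces `k₁, k₂` by their conjugates, so reality is decided by the signs of
`F`. Always `F(x) > 0`, so `k₂` is imaginary. On the region `A`, `F(y) > 0` makes `k₁` imaginary
too, and `N` meets its conjugate trivially. On `B`, `F(y) < 0` makes `k₁` real, and the intersection
is the line spanned by `∂_y + k₁ (∂_ψ - w ∂_t)`; the two signs of `k₁` give different lines.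

The obstruction to speciality is one component. The vector `X = ∂_x + k₂ ∂_φ` lies in `N`, `∂_t`
lies in `N^⊥`, and `C(X, ∂_t, X, ∂_t) = λ / (F(y) (x - y))` never vanishes (`weylC_ring`). Only
`k₂²` enters, so the same computation excludes all four structures. In vacuum the Cotton-York tensor
is zero, so either optical structure on a nonempty `B` refutes the converse of Goldberg-Sachs. -/

theorem forall_fin_five {P : Fin 5 → Prop} (h0 : P 0) (h1 : P 1) (h2 : P 2) (h3 : P 3)
    (h4 : P 4) : ∀ i, P i := by
  intro i
  fin_cases i <;> assumption

/-! ### Calculus of partial derivatives. -/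

/-- The linear form with the given components. -/
def linForm (v : Fin 5 → ℝ) : Pt →L[ℝ] ℝ := ∑ i, v i • ContinuousLinearMap.proj i

theorem linForm_apply (v : Fin 5 → ℝ) (z : Pt) : linForm v z = ∑ i, v i * z i := by
  simp [linForm]

/-- `f` is differentiable at `p` with partial derivatives `v`. -/
def HasPD (f : Pt → ℝ) (p : Pt) (v : Fin 5 → ℝ) : Prop := HasFDerivAt f (linForm v) p

namespace HasPD

variable {f h : Pt → ℝ} {p : Pt} {u v : Fin 5 → ℝ}

theorem pd_eq (hf : HasPD f p v) (i : Fin 5) : pd i f p = v i := by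
  unfold pd
  rw [HasFDerivAt.fderiv hf, linForm_apply]
  simp [Pi.single_apply]

theorem congr_deriv (hf : HasPD f p u) (e : ∀ i, u i = v i) : HasPD f p v := by
  rwa [← funext e]

theorem congr_fun (hf : HasPD f p u) (e : ∀ q, h q = f q) : HasPD h p u := by
  rwa [funext e]

theorem congr_of_eventuallyEq (hf : HasPD f p u) (e : h =ᶠ[nhds p] f) : HasPD h p u :=
  HasFDerivAt.congr_of_eventuallyEq hf e

theorem const (c : ℝ) : HasPD (fun _ => c) p 0 :=
  (hasFDerivAt_const c p).congr_fderiv <| ContinuousLinearMap.ext fun z => by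
    simp [linForm_apply]

theorem coord (i : Fin 5) : HasPD (fun q => q i) p (Pi.single i 1) :=
  ((ContinuousLinearMap.proj i : Pt →L[ℝ] ℝ).hasFDerivAt (x := p)).congr_fderiv <|
    ContinuousLinearMap.ext fun z => by simp [linForm_apply, Pi.single_apply]

theorem add (hf : HasPD f p u) (hh : HasPD h p v) : HasPD (fun q => f q + h q) p (u + v) :=
  (HasFDerivAt.fun_add hf hh).congr_fderiv <| ContinuousLinearMap.ext fun z => by
    simp [linForm_apply, add_mul, Finset.sum_add_distrib]

theorem neg (hf : HasPD f p u) : HasPD (fun q => -f q) p (-u) :=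
  (HasFDerivAt.fun_neg hf).congr_fderiv <| ContinuousLinearMap.ext fun z => by
    simp [linForm_apply]

theorem sub (hf : HasPD f p u) (hh : HasPD h p v) : HasPD (fun q => f q - h q) p (u - v) :=
  (HasFDerivAt.fun_sub hf hh).congr_fderiv <| ContinuousLinearMap.ext fun z => by
    simp [linForm_apply, sub_mul]

theorem mul (hf : HasPD f p u) (hh : HasPD h p v) :
    HasPD (fun q => f q * h q) p (f p • v + h p • u) :=
  (HasFDerivAt.fun_mul hf hh).congr_fderiv <| ContinuousLinearMap.ext fun z => by
    simp [linForm_apply, add_mul, Finset.sum_add_distrib, Finset.mul_sum, mul_assoc]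

theorem inv (hf : HasPD f p u) (h0 : f p ≠ 0) :
    HasPD (fun q => (f q)⁻¹) p (-(f p ^ 2)⁻¹ • u) :=
  ((hasDerivAt_inv h0).comp_hasFDerivAt p hf).congr_fderiv <| ContinuousLinearMap.ext fun z => by
    simp [linForm_apply, Finset.mul_sum, mul_assoc]

theorem div (hf : HasPD f p u) (hh : HasPD h p v) (h0 : h p ≠ 0) :
    HasPD (fun q => f q / h q) p (f p • (-(h p ^ 2)⁻¹ • v) + (h p)⁻¹ • u) := by
  simpa only [div_eq_mul_inv] using hf.mul (hh.inv h0)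

/-- Keeping gradients in the form `f · u` makes products, powers and quotients act additively on the
logarithmic derivatives `u`, and requires no division by `f`. -/
theorem mul_of_log (hf : HasPD f p (fun m => f p * u m)) (hh : HasPD h p (fun m => h p * v m)) :
    HasPD (fun q => f q * h q) p (fun m => f p * h p * (u m + v m)) :=
  (hf.mul hh).congr_deriv fun m => by
    simp
    ring

theorem neg_of_log (hf : HasPD f p (fun m => f p * u m)) :
    HasPD (fun q => -f q) p (fun m => -f p * u m) :=
  hf.neg.congr_deriv fun m => by simp

theorem sq_of_log (hf : HasPD f p (fun m => f p * u m)) :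
    HasPD (fun q => f q ^ 2) p (fun m => f p ^ 2 * (2 * u m)) :=
  ((hf.mul hf).congr_fun fun q => sq (f q)).congr_deriv fun m => by
    simp
    ring

theorem div_of_log (hf : HasPD f p (fun m => f p * u m)) (hh : HasPD h p (fun m => h p * v m)) (h0 : h p ≠ 0) :
    HasPD (fun q => f q / h q) p (fun m => f p / h p * (u m - v m)) :=
  (hf.div hh h0).congr_deriv fun m => by
    simp
    field_simp
    ring

end HasPD

/-! ### Connection of a metric with one twisted direction. -/

/-- The coefficients of a metric `a dx² + b dy² + c dφ² + d dψ² - f (dt + w dψ)²`, with the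
logarithmic derivatives of `a`, `b`, `c`, `d`, `f`, their derivatives, and the derivatives of `w`
(which are taken to be constant). The last index is that of the last derivative. -/
structure BlockData where
  (a b c d f w : Pt → ℝ)
  (A B C D F : Fin 5 → Pt → ℝ)
  (AA BB CC DD FF : Fin 5 → Fin 5 → Pt → ℝ)
  W : Fin 5 → ℝ

namespace BlockData

variable (S : BlockData)

/-- The metric with the given coefficients. -/
def metric (p : Pt) : Matrix (Fin 5) (Fin 5) ℝ :=
  !![S.a p, 0, 0, 0, 0;
     0, S.b p, 0, 0, 0;
     0, 0, S.c p, 0, 0;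
     0, 0, 0, S.d p - S.f p * S.w p ^ 2, -(S.f p * S.w p);
     0, 0, 0, -(S.f p * S.w p), -S.f p]

/-- The inverse metric. -/
def metricInv (p : Pt) : Matrix (Fin 5) (Fin 5) ℝ :=
  !![(S.a p)⁻¹, 0, 0, 0, 0;
     0, (S.b p)⁻¹, 0, 0, 0;
     0, 0, (S.c p)⁻¹, 0, 0;
     0, 0, 0, (S.d p)⁻¹, -(S.w p / S.d p);
     0, 0, 0, -(S.w p / S.d p), S.w p ^ 2 / S.d p - (S.f p)⁻¹]

/-- The partial derivatives of the metric. -/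
def dMetric (m : Fin 5) (p : Pt) : Matrix (Fin 5) (Fin 5) ℝ :=
  !![S.a p * S.A m p, 0, 0, 0, 0;
     0, S.b p * S.B m p, 0, 0, 0;
     0, 0, S.c p * S.C m p, 0, 0;
     0, 0, 0, S.d p * S.D m p - S.f p * S.F m p * S.w p ^ 2 - 2 * S.f p * S.w p * S.W m,
       -(S.f p * S.F m p * S.w p + S.f p * S.W m);
     0, 0, 0, -(S.f p * S.F m p * S.w p + S.f p * S.W m), -(S.f p * S.F m p)]

/-- The Christoffel symbols, when the coefficients depend on `x` and `y` only and `w` on `y`. -/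
def gam (p : Pt) : Fin 5 → Matrix (Fin 5) (Fin 5) ℝ :=
  ![!![S.A 0 p / 2, S.A 1 p / 2, 0, 0, 0;
       S.A 1 p / 2, -(S.b p / S.a p * S.B 0 p) / 2, 0, 0, 0;
       0, 0, -(S.c p / S.a p * S.C 0 p) / 2, 0, 0;
       0, 0, 0, -(S.d p / S.a p * S.D 0 p) / 2 + S.f p / S.a p * S.F 0 p * S.w p ^ 2 / 2,
         S.f p / S.a p * S.F 0 p * S.w p / 2;
       0, 0, 0, S.f p / S.a p * S.F 0 p * S.w p / 2, S.f p / S.a p * S.F 0 p / 2],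
    !![-(S.a p / S.b p * S.A 1 p) / 2, S.B 0 p / 2, 0, 0, 0;
       S.B 0 p / 2, S.B 1 p / 2, 0, 0, 0;
       0, 0, -(S.c p / S.b p * S.C 1 p) / 2, 0, 0;
       0, 0, 0, -(S.d p / S.b p * S.D 1 p) / 2 + S.f p / S.b p * S.F 1 p * S.w p ^ 2 / 2
           + S.f p / S.b p * S.w p * S.W 1,
         S.f p / S.b p * S.F 1 p * S.w p / 2 + S.f p / S.b p * S.W 1 / 2;
       0, 0, 0, S.f p / S.b p * S.F 1 p * S.w p / 2 + S.f p / S.b p * S.W 1 / 2,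
         S.f p / S.b p * S.F 1 p / 2],
    !![0, 0, S.C 0 p / 2, 0, 0;
       0, 0, S.C 1 p / 2, 0, 0;
       S.C 0 p / 2, S.C 1 p / 2, 0, 0, 0;
       0, 0, 0, 0, 0;
       0, 0, 0, 0, 0],
    !![0, 0, 0, S.D 0 p / 2, 0;
       0, 0, 0, S.D 1 p / 2 - S.f p / S.d p * S.w p * S.W 1 / 2, -(S.f p / S.d p * S.W 1) / 2;
       0, 0, 0, 0, 0;
       S.D 0 p / 2, S.D 1 p / 2 - S.f p / S.d p * S.w p * S.W 1 / 2, 0, 0, 0;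
       0, -(S.f p / S.d p * S.W 1) / 2, 0, 0, 0],
    !![0, 0, 0, S.w p * (S.F 0 p - S.D 0 p) / 2, S.F 0 p / 2;
       0, 0, 0, S.w p * (S.F 1 p - S.D 1 p) / 2 + S.W 1 / 2
         + S.f p / S.d p * S.w p ^ 2 * S.W 1 / 2, S.F 1 p / 2 + S.f p / S.d p * S.w p * S.W 1 / 2;
       0, 0, 0, 0, 0;
       S.w p * (S.F 0 p - S.D 0 p) / 2, S.w p * (S.F 1 p - S.D 1 p) / 2 + S.W 1 / 2
         + S.f p / S.d p * S.w p ^ 2 * S.W 1 / 2, 0, 0, 0;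
       S.F 0 p / 2, S.F 1 p / 2 + S.f p / S.d p * S.w p * S.W 1 / 2, 0, 0, 0]]

/-- The first-order hypotheses at a point. -/
structure FirstOrder (p : Pt) : Prop where
  a0 : S.a p ≠ 0
  b0 : S.b p ≠ 0
  c0 : S.c p ≠ 0
  d0 : S.d p ≠ 0
  f0 : S.f p ≠ 0
  ha : HasPD S.a p (fun m => S.a p * S.A m p)
  hb : HasPD S.b p (fun m => S.b p * S.B m p)
  hc : HasPD S.c p (fun m => S.c p * S.C m p)
  hd : HasPD S.d p (fun m => S.d p * S.D m p)
  hf : HasPD S.f p (fun m => S.f p * S.F m p)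
  hw : HasPD S.w p S.W
  hA : ∀ m : Fin 5, 1 < m → S.A m p = 0 ∧ S.B m p = 0 ∧ S.C m p = 0 ∧ S.D m p = 0 ∧ S.F m p = 0
  hW : ∀ m : Fin 5, m ≠ 1 → S.W m = 0

variable {S} {p : Pt}

theorem FirstOrder.inv_metric (H : S.FirstOrder p) : (S.metric p)⁻¹ = S.metricInv p := by
  have := H.a0
  have := H.b0
  have := H.c0
  have := H.d0
  have := H.f0
  apply Matrix.inv_eq_right_inv
  ext i j
  fin_cases i <;> fin_cases j <;>
    simp [Matrix.mul_apply, Fin.sum_univ_five, metric, metricInv] <;> field_simp <;> ring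

theorem FirstOrder.hasPD_metric (H : S.FirstOrder p) (i j : Fin 5) :
    HasPD (fun q => S.metric q i j) p (fun m => S.dMetric m p i j) := by
  have h0 : HasPD (fun _ => 0) p (fun _ => 0) := HasPD.const 0
  have h44 := H.hf.neg
  have h34 := (H.hf.mul H.hw).neg
  have h33 := H.hd.sub (H.hf.mul (H.hw.mul H.hw))
  fin_cases i <;> fin_cases j <;> simp only [metric, dMetric] <;> first
    | exact h0 | exact H.ha | exact H.hb | exact H.hc
    | exact h44.congr_deriv fun m => by simp
    | exact h34.congr_deriv fun m => by simp; ring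
    | exact (h33.congr_fun fun q => by simp [sq]).congr_deriv fun m => by simp; ring

set_option maxHeartbeats 1000000 in
theorem FirstOrder.christoffel_eq (H : S.FirstOrder p) (k i j : Fin 5) :
    christoffel S.metric k i j p = S.gam p k i j := by
  have := H.a0
  have := H.b0
  have := H.c0
  have := H.d0
  have := H.f0
  obtain ⟨a2, b2, c2, d2, f2⟩ := H.hA 2 (by decide)
  obtain ⟨a3, b3, c3, d3, f3⟩ := H.hA 3 (by decide)
  obtain ⟨a4, b4, c4, d4, f4⟩ := H.hA 4 (by decide)
  have w0 := H.hW 0 (by decide)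
  have w2 := H.hW 2 (by decide)
  have w3 := H.hW 3 (by decide)
  have w4 := H.hW 4 (by decide)
  unfold christoffel
  simp only [H.inv_metric, (H.hasPD_metric _ _).pd_eq]
  fin_cases k <;> fin_cases i <;> fin_cases j <;>
    simp [Fin.sum_univ_five, metricInv, dMetric, gam, a2, a3, a4, b2, b3, b4, c2, c3, c4,
      d2, d3, d4, f2, f3, f4, w0, w2, w3, w4] <;> field_simp <;> ring

variable (S)

/-- The partial derivatives of the Christoffel symbols. -/
def dGam (m : Fin 5) (p : Pt) : Fin 5 → Matrix (Fin 5) (Fin 5) ℝ :=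
  let a := S.a p
  let b := S.b p
  let c := S.c p
  let d := S.d p
  let f := S.f p
  let w := S.w p
  let A := fun k => S.A k p
  let B := fun k => S.B k p
  let C := fun k => S.C k p
  let D := fun k => S.D k p
  let F := fun k => S.F k p
  let A' := fun k => S.AA k m p
  let B' := fun k => S.BB k m p
  let C' := fun k => S.CC k m p
  let D' := fun k => S.DD k m p
  let F' := fun k => S.FF k m p
  let W := S.W
  ![!![A' 0 / 2, A' 1 / 2, 0, 0, 0;
       A' 1 / 2, -(b / a * (B 0 * (B m - A m) + B' 0)) / 2, 0, 0, 0;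
       0, 0, -(c / a * (C 0 * (C m - A m) + C' 0)) / 2, 0, 0;
       0, 0, 0, -(d / a * (D 0 * (D m - A m) + D' 0)) / 2
           + f / a * (F 0 * (F m - A m) + F' 0) * w ^ 2 / 2 + f / a * F 0 * w * W m,
         f / a * (F 0 * (F m - A m) + F' 0) * w / 2 + f / a * F 0 * W m / 2;
       0, 0, 0, f / a * (F 0 * (F m - A m) + F' 0) * w / 2 + f / a * F 0 * W m / 2,
         f / a * (F 0 * (F m - A m) + F' 0) / 2],
    !![-(a / b * (A 1 * (A m - B m) + A' 1)) / 2, B' 0 / 2, 0, 0, 0;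
       B' 0 / 2, B' 1 / 2, 0, 0, 0;
       0, 0, -(c / b * (C 1 * (C m - B m) + C' 1)) / 2, 0, 0;
       0, 0, 0, -(d / b * (D 1 * (D m - B m) + D' 1)) / 2
           + f / b * (F 1 * (F m - B m) + F' 1) * w ^ 2 / 2 + f / b * F 1 * w * W m
           + f / b * (F m - B m) * w * W 1 + f / b * W m * W 1,
         f / b * (F 1 * (F m - B m) + F' 1) * w / 2 + f / b * F 1 * W m / 2
           + f / b * (F m - B m) * W 1 / 2;
       0, 0, 0, f / b * (F 1 * (F m - B m) + F' 1) * w / 2 + f / b * F 1 * W m / 2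
           + f / b * (F m - B m) * W 1 / 2,
         f / b * (F 1 * (F m - B m) + F' 1) / 2],
    !![0, 0, C' 0 / 2, 0, 0;
       0, 0, C' 1 / 2, 0, 0;
       C' 0 / 2, C' 1 / 2, 0, 0, 0;
       0, 0, 0, 0, 0;
       0, 0, 0, 0, 0],
    !![0, 0, 0, D' 0 / 2, 0;
       0, 0, 0, D' 1 / 2 - f / d * (F m - D m) * w * W 1 / 2 - f / d * W m * W 1 / 2,
         -(f / d * (F m - D m) * W 1) / 2;
       0, 0, 0, 0, 0;
       D' 0 / 2, D' 1 / 2 - f / d * (F m - D m) * w * W 1 / 2 - f / d * W m * W 1 / 2, 0, 0, 0;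
       0, -(f / d * (F m - D m) * W 1) / 2, 0, 0, 0],
    !![0, 0, 0, (W m * (F 0 - D 0) + w * (F' 0 - D' 0)) / 2, F' 0 / 2;
       0, 0, 0, (W m * (F 1 - D 1) + w * (F' 1 - D' 1)) / 2 + f / d * (F m - D m) * w ^ 2 * W 1 / 2
           + f / d * w * W m * W 1,
         F' 1 / 2 + f / d * (F m - D m) * w * W 1 / 2 + f / d * W m * W 1 / 2;
       0, 0, 0, 0, 0;
       (W m * (F 0 - D 0) + w * (F' 0 - D' 0)) / 2,
         (W m * (F 1 - D 1) + w * (F' 1 - D' 1)) / 2 + f / d * (F m - D m) * w ^ 2 * W 1 / 2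
           + f / d * w * W m * W 1, 0, 0, 0;
       F' 0 / 2, F' 1 / 2 + f / d * (F m - D m) * w * W 1 / 2 + f / d * W m * W 1 / 2, 0, 0, 0]]

/-- The second-order hypotheses at a point. -/
structure SecondOrder (p : Pt) : Prop where
  nhds : ∀ᶠ q in nhds p, S.FirstOrder q
  hAA : ∀ k, HasPD (S.A k) p (fun m => S.AA k m p)
  hBB : ∀ k, HasPD (S.B k) p (fun m => S.BB k m p)
  hCC : ∀ k, HasPD (S.C k) p (fun m => S.CC k m p)
  hDD : ∀ k, HasPD (S.D k) p (fun m => S.DD k m p)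
  hFF : ∀ k, HasPD (S.F k) p (fun m => S.FF k m p)
  h0 : ∀ k m : Fin 5, 1 < m →
    S.AA k m p = 0 ∧ S.BB k m p = 0 ∧ S.CC k m p = 0 ∧ S.DD k m p = 0 ∧ S.FF k m p = 0

variable {S} {p : Pt}

/-- Every entry is a polynomial in ratios of coefficients, logarithmic derivatives, `w` and the
constant `W 1`. A ratio such as `b / a` has logarithmic derivative `B - A`, whence the shape of
`dGam`. -/
theorem SecondOrder.hasPD_gam (H : S.SecondOrder p) : ∀ k i j : Fin 5,
    HasPD (fun q => S.gam q k i j) p (fun m => S.dGam m p k i j) := by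
  have G := H.nhds.self_of_nhds
  have ca := G.hc.div_of_log G.ha G.a0
  have ba := G.hb.div_of_log G.ha G.a0
  have da := G.hd.div_of_log G.ha G.a0
  have fa := G.hf.div_of_log G.ha G.a0
  have ab := G.ha.div_of_log G.hb G.b0
  have cb := G.hc.div_of_log G.hb G.b0
  have db := G.hd.div_of_log G.hb G.b0
  have fb := G.hf.div_of_log G.hb G.b0
  have fd := G.hf.div_of_log G.hd G.d0
  have k1 := HasPD.const (p := p) (S.W 1)
  have h2 := HasPD.const (p := p) (1 / 2)
  have z : HasPD (fun _ => 0) p (fun _ => 0) := HasPD.const 0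
  have g000 : HasPD (fun q => S.gam q 0 0 0) p (fun m => S.dGam m p 0 0 0) :=
    (((H.hAA 0).mul h2).congr_fun fun q => by simp [gam]; ring).congr_deriv fun m => by
      simp [dGam]; ring
  have g001 : HasPD (fun q => S.gam q 0 0 1) p (fun m => S.dGam m p 0 0 1) :=
    (((H.hAA 1).mul h2).congr_fun fun q => by simp [gam]; ring).congr_deriv fun m => by
      simp [dGam]; ring
  have g011 : HasPD (fun q => S.gam q 0 1 1) p (fun m => S.dGam m p 0 1 1) :=
    (((ba.mul (H.hBB 0)).mul h2).neg.congr_fun fun q => by simp [gam]; ring).congr_deriv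
      fun m => by simp [dGam]; ring
  have g022 : HasPD (fun q => S.gam q 0 2 2) p (fun m => S.dGam m p 0 2 2) :=
    (((ca.mul (H.hCC 0)).mul h2).neg.congr_fun fun q => by simp [gam]; ring).congr_deriv
      fun m => by simp [dGam]; ring
  have g033 : HasPD (fun q => S.gam q 0 3 3) p (fun m => S.dGam m p 0 3 3) :=
    ((((fa.mul (H.hFF 0)).mul (G.hw.mul G.hw)).sub (da.mul (H.hDD 0))).mul h2 |>.congr_fun
      fun q => by simp [gam]; ring).congr_deriv fun m => by simp [dGam]; ring
  have g034 : HasPD (fun q => S.gam q 0 3 4) p (fun m => S.dGam m p 0 3 4) :=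
    (((fa.mul (H.hFF 0)).mul G.hw).mul h2 |>.congr_fun
      fun q => by simp [gam]; ring).congr_deriv fun m => by simp [dGam]; ring
  have g044 : HasPD (fun q => S.gam q 0 4 4) p (fun m => S.dGam m p 0 4 4) :=
    ((fa.mul (H.hFF 0)).mul h2 |>.congr_fun
      fun q => by simp [gam]; ring).congr_deriv fun m => by simp [dGam]; ring
  have g100 : HasPD (fun q => S.gam q 1 0 0) p (fun m => S.dGam m p 1 0 0) :=
    (((ab.mul (H.hAA 1)).mul h2).neg.congr_fun fun q => by simp [gam]; ring).congr_deriv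
      fun m => by simp [dGam]; ring
  have g101 : HasPD (fun q => S.gam q 1 0 1) p (fun m => S.dGam m p 1 0 1) :=
    (((H.hBB 0).mul h2).congr_fun fun q => by simp [gam]; ring).congr_deriv fun m => by
      simp [dGam]; ring
  have g111 : HasPD (fun q => S.gam q 1 1 1) p (fun m => S.dGam m p 1 1 1) :=
    (((H.hBB 1).mul h2).congr_fun fun q => by simp [gam]; ring).congr_deriv fun m => by
      simp [dGam]; ring
  have g122 : HasPD (fun q => S.gam q 1 2 2) p (fun m => S.dGam m p 1 2 2) :=
    (((cb.mul (H.hCC 1)).mul h2).neg.congr_fun fun q => by simp [gam]; ring).congr_deriv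
      fun m => by simp [dGam]; ring
  have g133 : HasPD (fun q => S.gam q 1 3 3) p (fun m => S.dGam m p 1 3 3) :=
    (((((fb.mul (H.hFF 1)).mul (G.hw.mul G.hw)).sub (db.mul (H.hDD 1))).mul h2).add
      ((fb.mul G.hw).mul k1) |>.congr_fun
      fun q => by simp [gam]; ring).congr_deriv fun m => by simp [dGam]; ring
  have g134 : HasPD (fun q => S.gam q 1 3 4) p (fun m => S.dGam m p 1 3 4) :=
    ((((fb.mul (H.hFF 1)).mul G.hw).add (fb.mul k1)).mul h2 |>.congr_fun
      fun q => by simp [gam]; ring).congr_deriv fun m => by simp [dGam]; ring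
  have g144 : HasPD (fun q => S.gam q 1 4 4) p (fun m => S.dGam m p 1 4 4) :=
    ((fb.mul (H.hFF 1)).mul h2 |>.congr_fun
      fun q => by simp [gam]; ring).congr_deriv fun m => by simp [dGam]; ring
  have g202 : HasPD (fun q => S.gam q 2 0 2) p (fun m => S.dGam m p 2 0 2) :=
    (((H.hCC 0).mul h2).congr_fun fun q => by simp [gam]; ring).congr_deriv fun m => by
      simp [dGam]; ring
  have g212 : HasPD (fun q => S.gam q 2 1 2) p (fun m => S.dGam m p 2 1 2) :=
    (((H.hCC 1).mul h2).congr_fun fun q => by simp [gam]; ring).congr_deriv fun m => by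
      simp [dGam]; ring
  have g303 : HasPD (fun q => S.gam q 3 0 3) p (fun m => S.dGam m p 3 0 3) :=
    (((H.hDD 0).mul h2).congr_fun fun q => by simp [gam]; ring).congr_deriv fun m => by
      simp [dGam]; ring
  have g313 : HasPD (fun q => S.gam q 3 1 3) p (fun m => S.dGam m p 3 1 3) :=
    (((H.hDD 1).sub ((fd.mul G.hw).mul k1)).mul h2 |>.congr_fun
      fun q => by simp [gam]; ring).congr_deriv fun m => by simp [dGam]; ring
  have g314 : HasPD (fun q => S.gam q 3 1 4) p (fun m => S.dGam m p 3 1 4) :=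
    ((fd.mul k1).mul h2 |>.neg.congr_fun
      fun q => by simp [gam]; ring).congr_deriv fun m => by simp [dGam]; ring
  have g403 : HasPD (fun q => S.gam q 4 0 3) p (fun m => S.dGam m p 4 0 3) :=
    ((G.hw.mul ((H.hFF 0).sub (H.hDD 0))).mul h2 |>.congr_fun
      fun q => by simp [gam]; ring).congr_deriv fun m => by simp [dGam]; ring
  have g404 : HasPD (fun q => S.gam q 4 0 4) p (fun m => S.dGam m p 4 0 4) :=
    (((H.hFF 0).mul h2).congr_fun fun q => by simp [gam]; ring).congr_deriv fun m => by
      simp [dGam]; ring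
  have g413 : HasPD (fun q => S.gam q 4 1 3) p (fun m => S.dGam m p 4 1 3) :=
    (((G.hw.mul ((H.hFF 1).sub (H.hDD 1))).add (k1.add ((fd.mul (G.hw.mul G.hw)).mul k1))).mul h2
      |>.congr_fun fun q => by simp [gam]; ring).congr_deriv fun m => by simp [dGam]; ring
  have g414 : HasPD (fun q => S.gam q 4 1 4) p (fun m => S.dGam m p 4 1 4) :=
    (((H.hFF 1).add ((fd.mul G.hw).mul k1)).mul h2 |>.congr_fun
      fun q => by simp [gam]; ring).congr_deriv fun m => by simp [dGam]; ring
  have z5 : ∀ j : Fin 5, HasPD (fun _ => (![0, 0, 0, 0, 0] : Fin 5 → ℝ) j) p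
      (fun _ => (![0, 0, 0, 0, 0] : Fin 5 → ℝ) j) := forall_fin_five z z z z z
  -- The nesting follows the sparsity pattern of `gam`; symmetry in the lower indices lets one fact
  -- serve two entries.
  exact forall_fin_five
    (forall_fin_five (forall_fin_five g000 g001 z z z) (forall_fin_five g001 g011 z z z)
      (forall_fin_five z z g022 z z) (forall_fin_five z z z g033 g034)
      (forall_fin_five z z z g034 g044))
    (forall_fin_five (forall_fin_five g100 g101 z z z) (forall_fin_five g101 g111 z z z)
      (forall_fin_five z z g122 z z) (forall_fin_five z z z g133 g134)
      (forall_fin_five z z z g134 g144))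
    (forall_fin_five (forall_fin_five z z g202 z z) (forall_fin_five z z g212 z z)
      (forall_fin_five g202 g212 z z z) z5 z5)
    (forall_fin_five (forall_fin_five z z z g303 z) (forall_fin_five z z z g313 g314)
      z5 (forall_fin_five g303 g313 z z z) (forall_fin_five z g314 z z z))
    (forall_fin_five (forall_fin_five z z z g403 g404) (forall_fin_five z z z g413 g414)
      z5 (forall_fin_five g403 g413 z z z) (forall_fin_five g404 g414 z z z))

/-- The closed form of the Christoffel symbols holds in a whole neighbourhood of `p`, so it may be
differentiated there. -/
theorem SecondOrder.riemannUp_eq (H : S.SecondOrder p) (a b c d : Fin 5) :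
    riemannUp S.metric a b c d p = S.dGam a p d b c - S.dGam b p d a c
      + ∑ e, (S.gam p d a e * S.gam p e b c - S.gam p d b e * S.gam p e a c) := by
  have h : ∀ k i j, HasPD (christoffel S.metric k i j) p (fun m => S.dGam m p k i j) :=
    fun k i j => (H.hasPD_gam k i j).congr_of_eventuallyEq
      (H.nhds.mono fun q hq => hq.christoffel_eq k i j)
  simp only [riemannUp, (h _ _ _).pd_eq, H.nhds.self_of_nhds.christoffel_eq]

variable (S)

/-- The logarithmic derivatives of the metric determinant. -/
def T (m : Fin 5) (p : Pt) : ℝ := S.A m p + S.B m p + S.C m p + S.D m p + S.F m p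

variable {S} {p : Pt}

/-! ### Ricci and Riemann components of the twisted metric. -/

section Ricci

set_option maxHeartbeats 1000000

/-- The underlying reason is invariance under `φ ↦ -φ` and under `(ψ, t) ↦ (-ψ, -t)`: only the
blocks `{x, y}`, `{φ}` and `{ψ, t}` can carry Ricci curvature. -/
theorem SecondOrder.ricci_eq_zero (H : S.SecondOrder p) {b c : Fin 5}
    (h : (b, c) ∉ ({(0, 0), (0, 1), (1, 0), (1, 1), (2, 2), (3, 3), (3, 4), (4, 3), (4, 4)} :
      Finset (Fin 5 × Fin 5))) :
    ricci S.metric b c p = 0 := by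
  obtain ⟨-, -, -, -, -, -, -, -, -, -, -, h1, hW⟩ := H.nhds.self_of_nhds
  simp only [ricci, H.riemannUp_eq, Fin.sum_univ_five]
  revert h
  fin_cases b <;> fin_cases c <;> first
    | (intro h; exact absurd h (by decide))
    | (intro _; simp [gam, dGam, h1, hW, H.h0])

theorem SecondOrder.ricci_four_four (H : S.SecondOrder p) :
    ricci S.metric 4 4 p = S.f p / (2 * S.a p) * (S.FF 0 0 p - S.A 0 p * S.F 0 p
        + S.T 0 p * S.F 0 p / 2)
      + S.f p / (2 * S.b p) * (S.FF 1 1 p - S.B 1 p * S.F 1 p + S.T 1 p * S.F 1 p / 2)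
      + S.f p ^ 2 * S.W 1 ^ 2 / (2 * S.b p * S.d p) := by
  obtain ⟨a0, b0, c0, d0, f0, -, -, -, -, -, -, h1, hW⟩ := H.nhds.self_of_nhds
  simp only [ricci, H.riemannUp_eq, Fin.sum_univ_five]
  simp [gam, dGam, T, h1, hW, H.h0]
  field_simp
  ring

/-- Writing `∂_ψ = (∂_ψ - w ∂_t) + w ∂_t` splits off `w` times the `tt` component. The remainder is
the Maxwell-type equation for the twist: the bracket is the `y`-logarithmic derivative of `f
√|abcdf| / (b d)`. -/
theorem SecondOrder.ricci_three_four (H : S.SecondOrder p) :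
    ricci S.metric 3 4 p = S.w p * ricci S.metric 4 4 p
      + S.f p * S.W 1 / (2 * S.b p) * (S.F 1 p - S.B 1 p - S.D 1 p + S.T 1 p / 2) := by
  obtain ⟨a0, b0, c0, d0, f0, -, -, -, -, -, -, h1, hW⟩ := H.nhds.self_of_nhds
  rw [H.ricci_four_four]
  simp only [ricci, H.riemannUp_eq, Fin.sum_univ_five]
  simp [gam, dGam, T, h1, hW, H.h0]
  field_simp
  ring

theorem SecondOrder.ricci_four_three (H : S.SecondOrder p) :
    ricci S.metric 4 3 p = S.w p * ricci S.metric 4 4 p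
      + S.f p * S.W 1 / (2 * S.b p) * (S.F 1 p - S.B 1 p - S.D 1 p + S.T 1 p / 2) := by
  obtain ⟨a0, b0, c0, d0, f0, -, -, -, -, -, -, h1, hW⟩ := H.nhds.self_of_nhds
  rw [H.ricci_four_four]
  simp only [ricci, H.riemannUp_eq, Fin.sum_univ_five]
  simp [gam, dGam, T, h1, hW, H.h0]
  field_simp
  ring

/-- The same splitting of `∂_ψ`, used twice: the terms in `w` are multiples of equations already
known, and only the component along `∂_ψ - w ∂_t` is new. -/
theorem SecondOrder.ricci_three_three (H : S.SecondOrder p) :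
    ricci S.metric 3 3 p = S.w p ^ 2 * ricci S.metric 4 4 p
      + S.w p * S.f p * S.W 1 / S.b p * (S.F 1 p - S.B 1 p - S.D 1 p + S.T 1 p / 2)
      - S.d p / (2 * S.a p) * (S.DD 0 0 p - S.A 0 p * S.D 0 p + S.T 0 p * S.D 0 p / 2)
      - S.d p / (2 * S.b p) * (S.DD 1 1 p - S.B 1 p * S.D 1 p + S.T 1 p * S.D 1 p / 2)
      + S.f p * S.W 1 ^ 2 / (2 * S.b p) := by
  obtain ⟨a0, b0, c0, d0, f0, -, -, -, -, -, -, h1, hW⟩ := H.nhds.self_of_nhds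
  rw [H.ricci_four_four]
  simp only [ricci, H.riemannUp_eq, Fin.sum_univ_five]
  simp [gam, dGam, T, h1, hW, H.h0]
  field_simp
  ring

theorem SecondOrder.ricci_two_two (H : S.SecondOrder p) :
    ricci S.metric 2 2 p =
      -(S.c p / (2 * S.a p)) * (S.CC 0 0 p - S.A 0 p * S.C 0 p + S.T 0 p * S.C 0 p / 2)
      - S.c p / (2 * S.b p) * (S.CC 1 1 p - S.B 1 p * S.C 1 p + S.T 1 p * S.C 1 p / 2) := by
  obtain ⟨a0, b0, c0, d0, f0, -, -, -, -, -, -, h1, hW⟩ := H.nhds.self_of_nhds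
  simp only [ricci, H.riemannUp_eq, Fin.sum_univ_five]
  simp [gam, dGam, T, h1, hW, H.h0]
  field_simp
  ring

theorem SecondOrder.ricci_zero_zero (H : S.SecondOrder p) :
    ricci S.metric 0 0 p =
      -(S.a p / (2 * S.b p)) * (S.AA 1 1 p - S.B 1 p * S.A 1 p + S.T 1 p * S.A 1 p / 2)
      - (S.BB 0 0 p + S.CC 0 0 p + S.DD 0 0 p + S.FF 0 0 p) / 2 + S.T 0 p * S.A 0 p / 4
      - (S.A 0 p ^ 2 + S.B 0 p ^ 2 + S.C 0 p ^ 2 + S.D 0 p ^ 2 + S.F 0 p ^ 2) / 4 := by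
  obtain ⟨a0, b0, c0, d0, f0, -, -, -, -, -, -, h1, hW⟩ := H.nhds.self_of_nhds
  simp only [ricci, H.riemannUp_eq, Fin.sum_univ_five]
  simp [gam, dGam, T, h1, hW, H.h0]
  field_simp
  ring

theorem SecondOrder.ricci_one_one (H : S.SecondOrder p) :
    ricci S.metric 1 1 p =
      -(S.b p / (2 * S.a p)) * (S.BB 0 0 p - S.A 0 p * S.B 0 p + S.T 0 p * S.B 0 p / 2)
      - (S.AA 1 1 p + S.CC 1 1 p + S.DD 1 1 p + S.FF 1 1 p) / 2 + S.T 1 p * S.B 1 p / 4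
      - (S.A 1 p ^ 2 + S.B 1 p ^ 2 + S.C 1 p ^ 2 + S.D 1 p ^ 2 + S.F 1 p ^ 2) / 4
      + S.f p * S.W 1 ^ 2 / (2 * S.d p) := by
  obtain ⟨a0, b0, c0, d0, f0, -, -, -, -, -, -, h1, hW⟩ := H.nhds.self_of_nhds
  simp only [ricci, H.riemannUp_eq, Fin.sum_univ_five]
  simp [gam, dGam, T, h1, hW, H.h0]
  field_simp
  ring

theorem SecondOrder.ricci_zero_one (H : S.SecondOrder p) :
    ricci S.metric 0 1 p = (S.BB 0 1 p - S.BB 1 0 p - S.CC 1 0 p - S.DD 1 0 p - S.FF 1 0 p) / 2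
      + S.T 0 p * S.A 1 p / 4 + S.T 1 p * S.B 0 p / 4
      - (S.A 0 p * S.A 1 p + 2 * S.A 1 p * S.B 0 p + S.B 0 p * S.B 1 p + S.C 0 p * S.C 1 p
        + S.D 0 p * S.D 1 p + S.F 0 p * S.F 1 p) / 4 := by
  obtain ⟨a0, b0, c0, d0, f0, -, -, -, -, -, -, h1, hW⟩ := H.nhds.self_of_nhds
  simp only [ricci, H.riemannUp_eq, Fin.sum_univ_five]
  simp [gam, dGam, T, h1, hW, H.h0]
  field_simp
  ring

/-- Differs in form from the `0 1` component because `AA`, `BB`, … are independent data here, with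
no symmetry of mixed derivatives assumed. -/
theorem SecondOrder.ricci_one_zero (H : S.SecondOrder p) :
    ricci S.metric 1 0 p = (S.AA 1 0 p - S.AA 0 1 p - S.CC 0 1 p - S.DD 0 1 p - S.FF 0 1 p) / 2
      + S.T 0 p * S.A 1 p / 4 + S.T 1 p * S.B 0 p / 4
      - (S.A 0 p * S.A 1 p + 2 * S.A 1 p * S.B 0 p + S.B 0 p * S.B 1 p + S.C 0 p * S.C 1 p
        + S.D 0 p * S.D 1 p + S.F 0 p * S.F 1 p) / 4 := by
  obtain ⟨a0, b0, c0, d0, f0, -, -, -, -, -, -, h1, hW⟩ := H.nhds.self_of_nhds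
  simp only [ricci, H.riemannUp_eq, Fin.sum_univ_five]
  simp [gam, dGam, T, h1, hW, H.h0]
  field_simp
  ring

/-- This component and the next three are the ones that occur in `C(X, ∂_t, X, ∂_t)` for `X` in the
span of `∂_x` and `∂_φ`. -/
theorem SecondOrder.riemann_zero_four_zero_four (H : S.SecondOrder p) :
    riemann S.metric 0 4 0 4 p = -S.f p * (S.FF 0 0 p / 2 + S.F 0 p ^ 2 / 4
      - S.F 0 p * S.A 0 p / 4 + S.a p / S.b p * S.A 1 p * S.F 1 p / 4) := by
  obtain ⟨a0, b0, c0, d0, f0, -, -, -, -, -, -, h1, hW⟩ := H.nhds.self_of_nhds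
  simp only [riemann, H.riemannUp_eq, Fin.sum_univ_five]
  simp [gam, dGam, metric, h1, hW, H.h0]
  field_simp
  ring

theorem SecondOrder.riemann_two_four_two_four (H : S.SecondOrder p) :
    riemann S.metric 2 4 2 4 p = -S.f p * S.c p / 4 *
      (S.F 0 p * S.C 0 p / S.a p + S.F 1 p * S.C 1 p / S.b p) := by
  obtain ⟨a0, b0, c0, d0, f0, -, -, -, -, -, -, h1, hW⟩ := H.nhds.self_of_nhds
  simp only [riemann, H.riemannUp_eq, Fin.sum_univ_five]
  simp [gam, dGam, metric, h1, hW, H.h0]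
  field_simp
  ring

theorem SecondOrder.riemann_zero_four_two_four (H : S.SecondOrder p) : riemann S.metric 0 4 2 4 p = 0 := by
  obtain ⟨-, -, -, -, -, -, -, -, -, -, -, h1, hW⟩ := H.nhds.self_of_nhds
  simp only [riemann, H.riemannUp_eq, Fin.sum_univ_five]
  simp [gam, dGam, metric, h1, hW, H.h0]

theorem SecondOrder.riemann_two_four_zero_four (H : S.SecondOrder p) : riemann S.metric 2 4 0 4 p = 0 := by
  obtain ⟨-, -, -, -, -, -, -, -, -, -, -, h1, hW⟩ := H.nhds.self_of_nhds
  simp only [riemann, H.riemannUp_eq, Fin.sum_univ_five]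
  simp [gam, dGam, metric, h1, hW, H.h0]

end Ricci

end BlockData

/-! ### The black ring as an instance of the twisted metric. -/

section Coefficients

variable (R lam nu : ℝ)

/-- The derivative of `ringG`. -/
def ringG' (ξ : ℝ) : ℝ := -nu - 2 * ξ + 3 * nu * ξ ^ 2

/-- The coefficients of the black ring metric and their derivatives. -/
def ringData : BlockData :=
  let F := ringF lam
  let G := ringG nu
  let u : Pt → ℝ := fun p => 1 / (p 0 - p 1)
  let l : Fin 5 → Pt → ℝ := fun i p => lam / F (p i)
  let m : Fin 5 → Pt → ℝ := fun i p => ringG' nu (p i) / G (p i)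
  let n : Fin 5 → Pt → ℝ := fun i p => (-2 + 6 * nu * p i) / G (p i) - m i p ^ 2
  { a := fun p => R ^ 2 / (p 0 - p 1) ^ 2 * F (p 1) ^ 2 / G (p 0)
    b := fun p => -(R ^ 2 / (p 0 - p 1) ^ 2 * F (p 0) * F (p 1) / G (p 1))
    c := fun p => R ^ 2 / (p 0 - p 1) ^ 2 * F (p 1) ^ 2 * G (p 0) / F (p 0)
    d := fun p => -(R ^ 2 / (p 0 - p 1) ^ 2 * F (p 0) * G (p 1))
    f := fun p => F (p 0) / F (p 1)
    w := fun p => R * √(lam * nu) * (1 + p 1)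
    A := fun k p => ![-2 * u p - m 0 p, 2 * u p - 2 * l 1 p, 0, 0, 0] k
    B := fun k p => ![-2 * u p - l 0 p, 2 * u p - l 1 p - m 1 p, 0, 0, 0] k
    C := fun k p => ![-2 * u p + m 0 p + l 0 p, 2 * u p - 2 * l 1 p, 0, 0, 0] k
    D := fun k p => ![-2 * u p - l 0 p, 2 * u p + m 1 p, 0, 0, 0] k
    F := fun k p => ![-l 0 p, l 1 p, 0, 0, 0] k
    AA := fun k i p => !![2 * u p ^ 2 - n 0 p, -2 * u p ^ 2, 0, 0, 0;
      -2 * u p ^ 2, 2 * u p ^ 2 - 2 * l 1 p ^ 2, 0, 0, 0;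
      0, 0, 0, 0, 0; 0, 0, 0, 0, 0; 0, 0, 0, 0, 0] k i
    BB := fun k i p => !![2 * u p ^ 2 - l 0 p ^ 2, -2 * u p ^ 2, 0, 0, 0;
      -2 * u p ^ 2, 2 * u p ^ 2 - l 1 p ^ 2 - n 1 p, 0, 0, 0;
      0, 0, 0, 0, 0; 0, 0, 0, 0, 0; 0, 0, 0, 0, 0] k i
    CC := fun k i p => !![2 * u p ^ 2 + n 0 p + l 0 p ^ 2, -2 * u p ^ 2, 0, 0, 0;
      -2 * u p ^ 2, 2 * u p ^ 2 - 2 * l 1 p ^ 2, 0, 0, 0;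
      0, 0, 0, 0, 0; 0, 0, 0, 0, 0; 0, 0, 0, 0, 0] k i
    DD := fun k i p => !![2 * u p ^ 2 - l 0 p ^ 2, -2 * u p ^ 2, 0, 0, 0;
      -2 * u p ^ 2, 2 * u p ^ 2 + n 1 p, 0, 0, 0;
      0, 0, 0, 0, 0; 0, 0, 0, 0, 0; 0, 0, 0, 0, 0] k i
    FF := fun k i p => !![-l 0 p ^ 2, 0, 0, 0, 0;
      0, l 1 p ^ 2, 0, 0, 0;
      0, 0, 0, 0, 0; 0, 0, 0, 0, 0; 0, 0, 0, 0, 0] k i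
    W := ![0, R * √(lam * nu), 0, 0, 0] }

theorem ringData_metric : (ringData R lam nu).metric = ringMetric R lam nu := by
  funext p
  rfl

/-- The points where the coefficients are regular and nonzero. -/
structure Regular (p : Pt) : Prop where
  xy : p 0 - p 1 ≠ 0
  Fx : ringF lam (p 0) ≠ 0
  Fy : ringF lam (p 1) ≠ 0
  Gx : ringG nu (p 0) ≠ 0
  Gy : ringG nu (p 1) ≠ 0

variable {R lam nu} {p : Pt}

theorem hasPD_ringF (i : Fin 5) :
    HasPD (fun q => ringF lam (q i)) p (Pi.single i (-lam)) :=
  ((HasPD.const 1).sub ((HasPD.const lam).mul (HasPD.coord i))).congr_deriv fun m => by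
    by_cases hm : m = i <;> simp [hm]

theorem hasPD_ringG (i : Fin 5) :
    HasPD (fun q => ringG nu (q i)) p (Pi.single i (ringG' nu (p i))) := by
  have h := HasPD.coord (p := p) i
  refine ((((HasPD.const 1).sub (h.mul h)).mul ((HasPD.const 1).sub
    ((HasPD.const nu).mul h))).congr_fun fun q => ?_).congr_deriv fun m => ?_
  · simp only [ringG]; ring
  · by_cases hm : m = i
    · subst hm; simp [ringG']; ring
    · simp [hm]

theorem hasPD_ringG' (i : Fin 5) :
    HasPD (fun q => ringG' nu (q i)) p (Pi.single i (-2 + 6 * nu * p i)) := by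
  have h := HasPD.coord (p := p) i
  refine ((((HasPD.const (-nu)).sub ((HasPD.const 2).mul h)).add ((HasPD.const (3 * nu)).mul
    (h.mul h))).congr_fun fun q => ?_).congr_deriv fun m => ?_
  · simp only [ringG']; ring
  · by_cases hm : m = i
    · subst hm; simp; ring
    · simp [hm]

theorem hasPD_recip (h : p 0 - p 1 ≠ 0) :
    HasPD (fun q => 1 / (q 0 - q 1)) p ![-(1 / (p 0 - p 1)) ^ 2, (1 / (p 0 - p 1)) ^ 2, 0, 0, 0] := by
  refine ((((HasPD.coord 0).sub (HasPD.coord 1)).inv h).congr_fun fun q => ?_).congr_deriv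
    fun m => ?_
  · simp
  · fin_cases m <;> simp

theorem hasPD_logF (i : Fin 5) (h : ringF lam (p i) ≠ 0) :
    HasPD (fun q => lam / ringF lam (q i)) p (Pi.single i ((lam / ringF lam (p i)) ^ 2)) := by
  refine ((HasPD.const lam).div (hasPD_ringF i) h).congr_deriv fun m => ?_
  by_cases hm : m = i
  · subst hm; simp; field_simp
  · simp [hm]

theorem hasPD_logG (i : Fin 5) (h : ringG nu (p i) ≠ 0) :
    HasPD (fun q => ringG' nu (q i) / ringG nu (q i)) p
      (Pi.single i ((-2 + 6 * nu * p i) / ringG nu (p i) - (ringG' nu (p i) / ringG nu (p i)) ^ 2)) := by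
  refine ((hasPD_ringG' i).div (hasPD_ringG i) h).congr_deriv fun m => ?_
  by_cases hm : m = i
  · subst hm; simp; field_simp; ring
  · simp [hm]

set_option maxHeartbeats 1000000 in
theorem Regular.firstOrder (hR : R ≠ 0) (H : Regular lam nu p) : (ringData R lam nu).FirstOrder p := by
  obtain ⟨h1, h2, h3, h4, h5⟩ := H
  have hx : HasPD (fun q => ringF lam (q 0)) p
      (fun m => ringF lam (p 0) * (![-(lam / ringF lam (p 0)), 0, 0, 0, 0] : Fin 5 → ℝ) m) :=
    (hasPD_ringF 0).congr_deriv fun m => by fin_cases m <;> simp [mul_div_cancel₀, h2]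
  have hy : HasPD (fun q => ringF lam (q 1)) p
      (fun m => ringF lam (p 1) * (![0, -(lam / ringF lam (p 1)), 0, 0, 0] : Fin 5 → ℝ) m) :=
    (hasPD_ringF 1).congr_deriv fun m => by fin_cases m <;> simp [mul_div_cancel₀, h3]
  have gx : HasPD (fun q => ringG nu (q 0)) p (fun m => ringG nu (p 0) *
      (![ringG' nu (p 0) / ringG nu (p 0), 0, 0, 0, 0] : Fin 5 → ℝ) m) :=
    (hasPD_ringG 0).congr_deriv fun m => by fin_cases m <;> simp [mul_div_cancel₀, h4]
  have gy : HasPD (fun q => ringG nu (q 1)) p (fun m => ringG nu (p 1) *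
      (![0, ringG' nu (p 1) / ringG nu (p 1), 0, 0, 0] : Fin 5 → ℝ) m) :=
    (hasPD_ringG 1).congr_deriv fun m => by fin_cases m <;> simp [mul_div_cancel₀, h5]
  have hxy : HasPD (fun q => q 0 - q 1) p (fun m => (p 0 - p 1) *
      (![1 / (p 0 - p 1), -(1 / (p 0 - p 1)), 0, 0, 0] : Fin 5 → ℝ) m) :=
    ((HasPD.coord 0).sub (HasPD.coord 1)).congr_deriv fun m => by
      fin_cases m <;> simp [mul_inv_cancel₀, h1]
  have r : HasPD (fun _ => R ^ 2) p (fun m => R ^ 2 * (0 : Fin 5 → ℝ) m) :=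
    (HasPD.const _).congr_deriv fun m => by simp
  have hW := r.div_of_log hxy.sq_of_log (pow_ne_zero 2 h1)
  constructor
  · simp only [ringData]; positivity
  · simp only [ringData]; exact neg_ne_zero.2 (by positivity)
  · simp only [ringData]; positivity
  · simp only [ringData]; exact neg_ne_zero.2 (by positivity)
  · simp only [ringData]; positivity
  -- The coefficient in front matches by definition, so only the sums of logarithmic derivatives
  -- remain to be compared.
  · exact ((hW.mul_of_log hy.sq_of_log).div_of_log gx h4).congr_deriv fun m =>
      congrArg ((ringData R lam nu).a p * ·) (by fin_cases m <;> simp [ringData] <;> ring)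
  · exact (((hW.mul_of_log hx).mul_of_log hy).div_of_log gy h5).neg_of_log.congr_deriv fun m =>
      congrArg ((ringData R lam nu).b p * ·) (by fin_cases m <;> simp [ringData] <;> ring)
  · exact (((hW.mul_of_log hy.sq_of_log).mul_of_log gx).div_of_log hx h2).congr_deriv fun m =>
      congrArg ((ringData R lam nu).c p * ·) (by fin_cases m <;> simp [ringData] <;> ring)
  · exact ((hW.mul_of_log hx).mul_of_log gy).neg_of_log.congr_deriv fun m =>
      congrArg ((ringData R lam nu).d p * ·) (by fin_cases m <;> simp [ringData] <;> ring)
  · exact (hx.div_of_log hy h3).congr_deriv fun m =>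
      congrArg ((ringData R lam nu).f p * ·) (by fin_cases m <;> simp [ringData])
  · refine ((HasPD.const (R * √(lam * nu))).mul ((HasPD.const 1).add
      (HasPD.coord 1))).congr_deriv fun m => ?_
    fin_cases m <;> simp [ringData]
  · intro m hm
    fin_cases m <;> simp [ringData] at hm ⊢
  · intro m hm
    fin_cases m <;> simp [ringData] at hm ⊢

set_option maxHeartbeats 1000000 in
theorem Regular.secondOrder (hR : R ≠ 0) {U : Set Pt} (hU : IsOpen U) (H : ∀ q ∈ U, Regular lam nu q)
    (hp : p ∈ U) : (ringData R lam nu).SecondOrder p := by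
  obtain ⟨h1, h2, h3, h4, h5⟩ := H p hp
  have lx := hasPD_logF (lam := lam) (p := p) 0 h2
  have ly := hasPD_logF (lam := lam) (p := p) 1 h3
  have mx := hasPD_logG (nu := nu) (p := p) 0 h4
  have my := hasPD_logG (nu := nu) (p := p) 1 h5
  have u := hasPD_recip h1
  have r := HasPD.const (p := p) 2
  have r' := HasPD.const (p := p) (-2)
  have z : HasPD (fun _ => 0) p (fun _ => 0) := HasPD.const 0
  have z' : HasPD (fun _ => 0) p (fun m => (![0, 0, 0, 0, 0] : Fin 5 → ℝ) m) :=
    z.congr_deriv fun m => by fin_cases m <;> rfl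
  refine ⟨Filter.Eventually.mono (hU.mem_nhds hp) fun q hq => (H q hq).firstOrder hR, ?_, ?_, ?_, ?_,
    ?_, ?_⟩
  · refine forall_fin_five (((r'.mul u).sub mx).congr_deriv fun m => ?_)
      (((r.mul u).sub (r.mul ly)).congr_deriv fun m => ?_) z' z' z' <;>
      fin_cases m <;> simp [ringData, Matrix.vecHead, Matrix.vecTail]
  · refine forall_fin_five (((r'.mul u).sub lx).congr_deriv fun m => ?_)
      ((((r.mul u).sub ly).sub my).congr_deriv fun m => ?_) z' z' z' <;>
      fin_cases m <;> simp [ringData, Matrix.vecHead, Matrix.vecTail]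
  · refine forall_fin_five ((((r'.mul u).add mx).add lx).congr_deriv fun m => ?_)
      (((r.mul u).sub (r.mul ly)).congr_deriv fun m => ?_) z' z' z' <;>
      fin_cases m <;> simp [ringData, Matrix.vecHead, Matrix.vecTail]
  · refine forall_fin_five (((r'.mul u).sub lx).congr_deriv fun m => ?_)
      (((r.mul u).add my).congr_deriv fun m => ?_) z' z' z' <;>
      fin_cases m <;> simp [ringData, Matrix.vecHead, Matrix.vecTail]
  · refine forall_fin_five (lx.neg.congr_deriv fun m => ?_)
      (ly.congr_deriv fun m => ?_) z' z' z' <;>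
      fin_cases m <;> simp [ringData, Matrix.vecHead, Matrix.vecTail]
  · intro k m hm
    fin_cases m <;> fin_cases k <;> simp [ringData] at hm ⊢

end Coefficients

/-! ### The vacuum equations and the nonvanishing Weyl component. -/

section RicciFlat

variable {R lam nu : ℝ} {p : Pt}

theorem ricci_ring_four_four (hR : R ≠ 0) (h : 0 ≤ lam * nu) (H : Regular lam nu p)
    (G : (ringData R lam nu).SecondOrder p) : ricci (ringMetric R lam nu) 4 4 p = 0 := by
  obtain ⟨h1, h2, h3, h4, h5⟩ := H
  -- The twist constant enters only through its square, where the root disappears; this makes the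
  -- equation rational.
  have hs : (R * √(lam * nu)) ^ 2 = R ^ 2 * (lam * nu) := by rw [mul_pow, Real.sq_sqrt h]
  rw [← ringData_metric, G.ricci_four_four]
  simp only [ringData, BlockData.T, Matrix.of_apply, Matrix.cons_val_zero, Matrix.cons_val_one, hs]
  -- Denominators are cleared while `F` and `G` are opaque nonzero atoms; unfolding them afterwards
  -- leaves a polynomial identity.
  field_simp
  simp only [ringF, ringG, ringG']
  ring

/-- For the black ring, `f √|abcdf| / (b d)` does not vary with `y`, so the twist equation holds
with constant `W 1`. -/
theorem ringData_three_four (R lam nu : ℝ) (p : Pt) :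
    (ringData R lam nu).F 1 p - (ringData R lam nu).B 1 p - (ringData R lam nu).D 1 p
      + (ringData R lam nu).T 1 p / 2 = 0 := by
  simp only [ringData, BlockData.T, Matrix.of_apply, Matrix.cons_val_zero, Matrix.cons_val_one]
  ring

theorem ricci_ring_three_three (hR : R ≠ 0) (h : 0 ≤ lam * nu) (H : Regular lam nu p)
    (G : (ringData R lam nu).SecondOrder p) : ricci (ringMetric R lam nu) 3 3 p = 0 := by
  have h44 := ricci_ring_four_four hR h H G
  have h34 := ringData_three_four R lam nu p
  obtain ⟨h1, h2, h3, h4, h5⟩ := H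
  have hs : (R * √(lam * nu)) ^ 2 = R ^ 2 * (lam * nu) := by rw [mul_pow, Real.sq_sqrt h]
  rw [← ringData_metric] at h44 ⊢
  rw [G.ricci_three_three, h34, h44, mul_zero, mul_zero]
  simp only [ringData, BlockData.T, Matrix.of_apply, Matrix.cons_val_zero, Matrix.cons_val_one, hs]
  field_simp
  simp only [ringF, ringG, ringG']
  ring

theorem ricci_ring_two_two (hR : R ≠ 0) (H : Regular lam nu p)
    (G : (ringData R lam nu).SecondOrder p) : ricci (ringMetric R lam nu) 2 2 p = 0 := by
  obtain ⟨h1, h2, h3, h4, h5⟩ := H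
  rw [← ringData_metric, G.ricci_two_two]
  simp only [ringData, BlockData.T, Matrix.of_apply, Matrix.cons_val_zero, Matrix.cons_val_one]
  field_simp
  simp only [ringF, ringG, ringG']
  ring

theorem ricci_ring_zero_zero (hR : R ≠ 0) (H : Regular lam nu p)
    (G : (ringData R lam nu).SecondOrder p) : ricci (ringMetric R lam nu) 0 0 p = 0 := by
  obtain ⟨h1, h2, h3, h4, h5⟩ := H
  rw [← ringData_metric, G.ricci_zero_zero]
  simp only [ringData, BlockData.T, Matrix.of_apply, Matrix.cons_val_zero, Matrix.cons_val_one]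
  field_simp
  simp only [ringF, ringG, ringG']
  ring

theorem ricci_ring_one_one (hR : R ≠ 0) (h : 0 ≤ lam * nu) (H : Regular lam nu p)
    (G : (ringData R lam nu).SecondOrder p) : ricci (ringMetric R lam nu) 1 1 p = 0 := by
  obtain ⟨h1, h2, h3, h4, h5⟩ := H
  have hs : (R * √(lam * nu)) ^ 2 = R ^ 2 * (lam * nu) := by rw [mul_pow, Real.sq_sqrt h]
  rw [← ringData_metric, G.ricci_one_one]
  simp only [ringData, BlockData.T, Matrix.of_apply, Matrix.cons_val_zero, Matrix.cons_val_one, hs]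
  field_simp
  simp only [ringF, ringG, ringG']
  ring

theorem ricci_ring_zero_one (H : Regular lam nu p)
    (G : (ringData R lam nu).SecondOrder p) : ricci (ringMetric R lam nu) 0 1 p = 0 := by
  obtain ⟨h1, h2, h3, h4, h5⟩ := H
  rw [← ringData_metric, G.ricci_zero_one]
  simp only [ringData, BlockData.T, Matrix.of_apply, Matrix.cons_val_zero, Matrix.cons_val_one]
  field_simp
  simp only [ringF, ringG, ringG']
  ring

theorem ricci_ring_one_zero (H : Regular lam nu p)
    (G : (ringData R lam nu).SecondOrder p) : ricci (ringMetric R lam nu) 1 0 p = 0 := by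
  obtain ⟨h1, h2, h3, h4, h5⟩ := H
  rw [← ringData_metric, G.ricci_one_zero]
  simp only [ringData, BlockData.T, Matrix.of_apply, Matrix.cons_val_zero, Matrix.cons_val_one]
  field_simp
  simp only [ringF, ringG, ringG']
  ring

/-- The black ring metric is Ricci-flat where it is regular. -/
theorem ricci_ring (hR : R ≠ 0) (h : 0 ≤ lam * nu) (H : Regular lam nu p)
    (G : (ringData R lam nu).SecondOrder p) (b c : Fin 5) : ricci (ringMetric R lam nu) b c p = 0 := by
  by_cases hbc : (b, c) ∉ ({(0, 0), (0, 1), (1, 0), (1, 1), (2, 2), (3, 3), (3, 4), (4, 3),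
      (4, 4)} : Finset (Fin 5 × Fin 5))
  · rw [← ringData_metric, G.ricci_eq_zero hbc]
  · have h44 := ricci_ring_four_four hR h H G
    have h34 := ringData_three_four R lam nu p
    have h' : ricci (ringMetric R lam nu) 3 4 p = 0 := by
      rw [← ringData_metric] at h44 ⊢
      rw [G.ricci_three_four, h34, h44, mul_zero, mul_zero, add_zero]
    have h'' : ricci (ringMetric R lam nu) 4 3 p = 0 := by
      rw [← ringData_metric] at h44 ⊢
      rw [G.ricci_four_three, h34, h44, mul_zero, mul_zero, add_zero]
    simp only [not_not, Finset.mem_insert, Finset.mem_singleton, Prod.mk.injEq] at hbc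
    rcases hbc with ⟨rfl, rfl⟩ | ⟨rfl, rfl⟩ | ⟨rfl, rfl⟩ | ⟨rfl, rfl⟩ | ⟨rfl, rfl⟩ | ⟨rfl, rfl⟩ |
      ⟨rfl, rfl⟩ | ⟨rfl, rfl⟩ | ⟨rfl, rfl⟩
    · exact ricci_ring_zero_zero hR H G
    · exact ricci_ring_zero_one H G
    · exact ricci_ring_one_zero H G
    · exact ricci_ring_one_one hR h H G
    · exact ricci_ring_two_two hR H G
    · exact ricci_ring_three_three hR h H G
    · exact h'
    · exact h''
    · exact h44

theorem weyl_eq_riemann {g : Pt → Matrix (Fin 5) (Fin 5) ℝ} (h : ∀ a b, ricci g a b p = 0)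
    (a b c d : Fin 5) : weyl g a b c d p = riemann g a b c d p := by
  simp [weyl, rho, scalarCurv, h]

/-- The component of the Weyl tensor that is not special. -/
theorem weylC_ring (hR : R ≠ 0) (h : 0 ≤ lam * nu) (H : Regular lam nu p)
    (G : (ringData R lam nu).SecondOrder p) (k : ℂ)
    (hk : k ^ 2 = -((ringF lam (p 0) / ringG nu (p 0) ^ 2 : ℝ) : ℂ)) :
    weylC (ringMetric R lam nu) p ![1, 0, k, 0, 0] ![0, 0, 0, 0, 1] ![1, 0, k, 0, 0]
      ![0, 0, 0, 0, 1] = ((lam / (ringF lam (p 1) * (p 0 - p 1)) : ℝ) : ℂ) := by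
  -- The factor `F(x) / G(x)²` is `a / c`. Since `a` and `c` have the same logarithmic derivative in
  -- `y`, the `y` terms cancel; so do those in `G'`. What is left is `f · (λ / F(x)) / (x - y)`,
  -- with no use of the explicit form of `F` or `G`.
  have e : riemann (ringMetric R lam nu) 0 4 0 4 p - ringF lam (p 0) / ringG nu (p 0) ^ 2 *
      riemann (ringMetric R lam nu) 2 4 2 4 p = lam / (ringF lam (p 1) * (p 0 - p 1)) := by
    obtain ⟨h1, h2, h3, h4, h5⟩ := H
    rw [← ringData_metric, G.riemann_zero_four_zero_four, G.riemann_two_four_two_four]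
    simp only [ringData, BlockData.T, Matrix.of_apply, Matrix.cons_val_zero, Matrix.cons_val_one]
    field_simp
    ring
  have e1 := G.riemann_zero_four_two_four
  have e2 := G.riemann_two_four_zero_four
  rw [ringData_metric] at e1 e2
  rw [← e]
  simp only [weylC, weyl_eq_riemann (ricci_ring hR h H G), Fin.sum_univ_five]
  simp [e1, e2]
  push_cast at hk
  linear_combination (riemann (ringMetric R lam nu) 2 4 2 4 p : ℂ) * hk

end RicciFlat

/-! ### Integrability and real index of distributions given by equations. -/

section Distributions

/-! Distributions given by `X² = k₂ X⁰`, `X³ = k₁ X¹`, `X⁴ = -w X³`. -/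

theorem pd_eq_zero_of_dep {f : Pt → ℂ} {i j : Fin 5} (hij : i ≠ j)
    (h : ∀ q q' : Pt, q j = q' j → f q = f q') (p : Pt) : pd i f p = 0 := by
  unfold pd
  by_cases hf : DifferentiableAt ℝ f p
  · rw [← hf.lineDeriv_eq_fderiv, lineDeriv]
    have : (fun t : ℝ => f (p + t • Pi.single i 1)) = fun _ => f p := by
      funext t
      apply h
      simp [Pi.single_apply, hij.symm]
    rw [this, deriv_const]
  -- Where `f` is not differentiable, `fderiv` takes the default value `0`, so no regularity is
  -- needed.
  · simp [fderiv_zero_of_not_differentiableAt hf]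

theorem pd_mul {f h : Pt → ℂ} {p : Pt} (hf : DifferentiableAt ℝ f p) (hh : DifferentiableAt ℝ h p)
    (i : Fin 5) : pd i (fun q => f q * h q) p = f p * pd i h p + pd i f p * h p := by
  unfold pd
  rw [fderiv_fun_mul hf hh]
  simp [mul_comm]

/-- The Leibniz rule: differentiating `X^m = k X^n` and `Y^m = k Y^n` leaves the error `X(k) Y^n -
Y(k) X^n`. It vanishes as soon as `X(k)` and `Y(k)` are proportional to `X^n` and `Y^n` with the
same factor. -/
theorem bracketC_of_eq_mul {X Y : Pt → CVec} {k : Pt → ℂ} {p : Pt} {m n : Fin 5}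
    (hX : ∀ i, DifferentiableAt ℝ (fun q => X q i) p)
    (hY : ∀ i, DifferentiableAt ℝ (fun q => Y q i) p) (hk : DifferentiableAt ℝ k p)
    (eX : ∀ᶠ q in nhds p, X q m = k q * X q n) (eY : ∀ᶠ q in nhds p, Y q m = k q * Y q n) :
    bracketC X Y p m = k p * bracketC X Y p n + (∑ i, X p i * pd i k p) * Y p n
      - (∑ i, Y p i * pd i k p) * X p n := by
  have hx : ∀ i, pd i (fun q => X q m) p = k p * pd i (fun q => X q n) p + pd i k p * X p n := by
    intro i
    rw [← pd_mul hk (hX n)]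
    unfold pd
    rw [Filter.EventuallyEq.fderiv_eq eX]
  have hy : ∀ i, pd i (fun q => Y q m) p = k p * pd i (fun q => Y q n) p + pd i k p * Y p n := by
    intro i
    rw [← pd_mul hk (hY n)]
    unfold pd
    rw [Filter.EventuallyEq.fderiv_eq eY]
  simp only [bracketC, hx, hy, Finset.mul_sum, Finset.sum_mul, ← Finset.sum_add_distrib,
    ← Finset.sum_sub_distrib]
  exact Finset.sum_congr rfl fun i _ => by ring

/-- Data for a distribution given by linear equations, over an open set. -/
structure NullData (U : Set Pt) (k₁ k₂ : Pt → ℂ) (w : Pt → ℝ) : Prop where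
  isOpen : IsOpen U
  smooth₁ : ContDiffOn ℝ ∞ k₁ U
  smooth₂ : ContDiffOn ℝ ∞ k₂ U
  smooth_w : ContDiffOn ℝ ∞ w U
  dep₁ : ∀ q q' : Pt, q 1 = q' 1 → k₁ q = k₁ q'
  dep₂ : ∀ q q' : Pt, q 0 = q' 0 → k₂ q = k₂ q'
  dep_w : ∀ q q' : Pt, q 1 = q' 1 → w q = w q'

/-- The distribution `N` is given over `U` by the linear equations. -/
def HasEqs (U : Set Pt) (N : Pt → Submodule ℂ CVec) (k₁ k₂ : Pt → ℂ) (w : Pt → ℝ) : Prop :=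
  ∀ p ∈ U, ∀ X, X ∈ N p ↔ X 2 = k₂ p * X 0 ∧ X 3 = k₁ p * X 1 ∧ X 4 = -w p * X 3

/-- The distribution `N` is given over `U` by the first two linear equations. -/
def HasOrthEqs (U : Set Pt) (N : Pt → Submodule ℂ CVec) (k₁ k₂ : Pt → ℂ) : Prop :=
  ∀ p ∈ U, ∀ X, X ∈ N p ↔ X 2 = k₂ p * X 0 ∧ X 3 = k₁ p * X 1

variable {U : Set Pt} {N : Pt → Submodule ℂ CVec} {k₁ k₂ : Pt → ℂ} {w : Pt → ℝ}

theorem NullData.neg₁ (H : NullData U k₁ k₂ w) : NullData U (fun p => -k₁ p) k₂ w :=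
  { H with
    smooth₁ := H.smooth₁.neg
    dep₁ := fun q q' h => by rw [H.dep₁ q q' h] }

/-- Here `k₂` depends on `x` alone, so `X(k₂) = X⁰ ∂_x k₂` and the error term is antisymmetrised to
zero; likewise for `k₁` and `y`. The equation for `X⁴` is not used, so this serves `N` and `N^⊥`
alike. -/
theorem NullData.bracket_eqs (H : NullData U k₁ k₂ w) {X Y : Pt → CVec}
    (hX : ContDiffOn ℝ ∞ X U) (hY : ContDiffOn ℝ ∞ Y U)
    (eX : ∀ p ∈ U, X p 2 = k₂ p * X p 0 ∧ X p 3 = k₁ p * X p 1)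
    (eY : ∀ p ∈ U, Y p 2 = k₂ p * Y p 0 ∧ Y p 3 = k₁ p * Y p 1) {p : Pt} (hp : p ∈ U) :
    bracketC X Y p 2 = k₂ p * bracketC X Y p 0 ∧ bracketC X Y p 3 = k₁ p * bracketC X Y p 1 := by
  have hU := H.isOpen.mem_nhds hp
  have dX : ∀ i, DifferentiableAt ℝ (fun q => X q i) p :=
    differentiableAt_pi.1 ((hX.contDiffAt hU).differentiableAt (by simp))
  have dY : ∀ i, DifferentiableAt ℝ (fun q => Y q i) p :=
    differentiableAt_pi.1 ((hY.contDiffAt hU).differentiableAt (by simp))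
  have d1 := (H.smooth₁.contDiffAt hU).differentiableAt (by simp)
  have d2 := (H.smooth₂.contDiffAt hU).differentiableAt (by simp)
  have z1 : ∀ i : Fin 5, i ≠ 1 → pd i k₁ p = 0 := fun i hi => pd_eq_zero_of_dep hi H.dep₁ p
  have z2 : ∀ i : Fin 5, i ≠ 0 → pd i k₂ p = 0 := fun i hi => pd_eq_zero_of_dep hi H.dep₂ p
  constructor
  · rw [bracketC_of_eq_mul dX dY d2 (Filter.Eventually.mono hU fun q hq => (eX q hq).1)
      (Filter.Eventually.mono hU fun q hq => (eY q hq).1)]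
    simp [Fin.sum_univ_five, z2]
    ring
  · rw [bracketC_of_eq_mul dX dY d1 (Filter.Eventually.mono hU fun q hq => (eX q hq).2)
      (Filter.Eventually.mono hU fun q hq => (eY q hq).2)]
    simp [Fin.sum_univ_five, z1]
    ring

theorem HasOrthEqs.isIntegrable (E : HasOrthEqs U N k₁ k₂) (H : NullData U k₁ k₂ w) :
    IsIntegrable U N := fun X Y hX hY hXN hYN p hp =>
  (E p hp _).2 (H.bracket_eqs hX hY (fun q hq => (E q hq _).1 (hXN q hq))
    (fun q hq => (E q hq _).1 (hYN q hq)) hp)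

theorem HasEqs.isIntegrable (E : HasEqs U N k₁ k₂ w) (H : NullData U k₁ k₂ w) :
    IsIntegrable U N := by
  intro X Y hX hY hXN hYN p hp
  have eX := fun q hq => (E q hq _).1 (hXN q hq)
  have eY := fun q hq => (E q hq _).1 (hYN q hq)
  obtain ⟨h1, h2⟩ := H.bracket_eqs hX hY (fun q hq => ⟨(eX q hq).1, (eX q hq).2.1⟩)
    (fun q hq => ⟨(eY q hq).1, (eY q hq).2.1⟩) hp
  refine (E p hp _).2 ⟨h1, h2, ?_⟩
  have hU := H.isOpen.mem_nhds hp
  have dX : ∀ i, DifferentiableAt ℝ (fun q => X q i) p :=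
    differentiableAt_pi.1 ((hX.contDiffAt hU).differentiableAt (by simp))
  have dY : ∀ i, DifferentiableAt ℝ (fun q => Y q i) p :=
    differentiableAt_pi.1 ((hY.contDiffAt hU).differentiableAt (by simp))
  have dw : DifferentiableAt ℝ (fun q => -(w q : ℂ)) p :=
    (Complex.ofRealCLM.differentiableAt.comp p
      ((H.smooth_w.contDiffAt hU).differentiableAt (by simp))).neg
  have zw : ∀ i : Fin 5, i ≠ 1 → pd i (fun q => -(w q : ℂ)) p = 0 := fun i hi =>
    pd_eq_zero_of_dep hi (fun q q' h => by rw [H.dep_w q q' h]) p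
  rw [bracketC_of_eq_mul dX dY dw (Filter.Eventually.mono hU fun q hq => (eX q hq).2.2)
      (Filter.Eventually.mono hU fun q hq => (eY q hq).2.2)]
  -- The error is `-w' (X¹ Y³ - Y¹ X³)`, that is, `dy ∧ dψ` on `N` up to a factor; it vanishes
  -- because `X³` and `Y³` are `k₁` times `X¹` and `Y¹`.
  simp [Fin.sum_univ_five, zw, (eX p hp).2.1, (eY p hp).2.1]
  ring

/-- The frame of the distribution. -/
def nullFrame (k₁ k₂ : Pt → ℂ) (w : Pt → ℝ) : Fin 2 → Pt → CVec :=
  ![fun p => ![0, 1, 0, k₁ p, -w p * k₁ p], fun p => ![1, 0, k₂ p, 0, 0]]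

theorem HasEqs.isSmoothSubbundle (E : HasEqs U N k₁ k₂ w) (H : NullData U k₁ k₂ w) :
    IsSmoothSubbundle U N 2 := by
  intro p hp
  have sw : ContDiffOn ℝ ∞ (fun q => (w q : ℂ)) U :=
    Complex.ofRealCLM.contDiff.comp_contDiffOn H.smooth_w
  refine ⟨U, H.isOpen, hp, subset_rfl, nullFrame k₁ k₂ w, ?_, fun q hq => ⟨?_, ?_⟩⟩
  · intro a
    rw [contDiffOn_pi]
    intro i
    fin_cases a <;> fin_cases i <;> simp [nullFrame] <;>
      first
        | exact contDiffOn_const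
        | exact H.smooth₁
        | exact H.smooth₂
        | exact (sw.mul H.smooth₁).neg
  · rw [Fintype.linearIndependent_iff]
    intro c hc
    have h0 := congrFun hc 0
    have h1 := congrFun hc 1
    simp [nullFrame] at h0 h1
    intro i
    fin_cases i
    · exact h1
    · exact h0
  · ext X
    have : (Set.range fun a => nullFrame k₁ k₂ w a q) =
        {![0, 1, 0, k₁ q, -w q * k₁ q], ![1, 0, k₂ q, 0, 0]} := by
      ext v
      simp [nullFrame, Fin.exists_fin_two, eq_comm, or_comm]
    rw [this, Submodule.mem_span_pair, E q hq X]
    constructor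
    · rintro ⟨s, t, rfl⟩
      simp
      refine ⟨?_, ?_, ?_⟩ <;> ring
    · rintro ⟨h2, h3, h4⟩
      refine ⟨X 1, X 0, ?_⟩
      ext i
      fin_cases i <;> simp [h2, h3, h4] <;> ring

/-- The equations are conjugated coefficient by coefficient; `w` is real and stays. -/
theorem HasEqs.conj (E : HasEqs U N k₁ k₂ w) :
    HasEqs U (fun p => conjSub (N p)) (fun p => star (k₁ p)) (fun p => star (k₂ p)) w := by
  intro p hp X
  change star X ∈ N p ↔ _
  rw [E p hp]
  refine and_congr ?_ (and_congr ?_ ?_)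
  · rw [← star_inj]; simp
  · rw [← star_inj]; simp
  · rw [← star_inj]; simp

theorem HasEqs.eq_of (E : HasEqs U N k₁ k₂ w) {N' : Pt → Submodule ℂ CVec} {k₁' k₂' : Pt → ℂ}
    (E' : HasEqs U N' k₁' k₂' w) {p : Pt} (hp : p ∈ U) (h1 : k₁ p = k₁' p) (h2 : k₂ p = k₂' p) :
    N p = N' p := by
  ext X
  rw [E p hp, E' p hp, h1, h2]

theorem HasEqs.ne_of (E : HasEqs U N k₁ k₂ w) {N' : Pt → Submodule ℂ CVec} {k₁' k₂' : Pt → ℂ}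
    (E' : HasEqs U N' k₁' k₂' w) {p : Pt} (hp : p ∈ U) (h : k₁ p ≠ k₁' p ∨ k₂ p ≠ k₂' p) :
    N p ≠ N' p := by
  intro e
  rcases h with h | h
  · have : (![0, 1, 0, k₁ p, -w p * k₁ p] : CVec) ∈ N p := (E p hp _).2 (by simp)
    rw [e, E' p hp] at this
    exact h (by simpa using this.2.1)
  · have : (![1, 0, k₂ p, 0, 0] : CVec) ∈ N p := (E p hp _).2 (by simp)
    rw [e, E' p hp] at this
    exact h (by simpa using this.1)

/-- The case in which neither coefficient is real: the distribution meets its conjugate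
trivially. -/
theorem HasEqs.inf_conj_eq_bot (E : HasEqs U N k₁ k₂ w) {p : Pt} (hp : p ∈ U)
    (h1 : star (k₁ p) ≠ k₁ p) (h2 : star (k₂ p) ≠ k₂ p) : N p ⊓ conjSub (N p) = ⊥ := by
  rw [eq_bot_iff]
  rintro X ⟨hX, hX'⟩
  obtain ⟨a, b, c⟩ := (E p hp X).1 hX
  obtain ⟨a', b', -⟩ := (E.conj p hp X).1 hX'
  have h0 : X 0 = 0 := by
    have : (star (k₂ p) - k₂ p) * X 0 = 0 := by rw [sub_mul, ← a, ← a', sub_self]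
    exact (mul_eq_zero.1 this).resolve_left (sub_ne_zero.2 h2)
  have h1 : X 1 = 0 := by
    have : (star (k₁ p) - k₁ p) * X 1 = 0 := by rw [sub_mul, ← b, ← b', sub_self]
    exact (mul_eq_zero.1 this).resolve_left (sub_ne_zero.2 h1)
  rw [Submodule.mem_bot]
  ext i
  fin_cases i <;> simp [a, b, c, h0, h1]

theorem HasEqs.isCRStructure (E : HasEqs U N k₁ k₂ w) (H : NullData U k₁ k₂ w)
    (h1 : ∀ p ∈ U, star (k₁ p) ≠ k₁ p) (h2 : ∀ p ∈ U, star (k₂ p) ≠ k₂ p) :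
    IsCRStructure U N 2 where
  subbundle := E.isSmoothSubbundle H
  inter_eq p hp := E.inf_conj_eq_bot hp (h1 p hp) (h2 p hp)
  integrable := E.isIntegrable H

/-- The real vector that spans the real line, if `k₁` is real. -/
def realVec (k₁ : Pt → ℂ) (w : Pt → ℝ) (p : Pt) : Pt := ![0, 1, 0, (k₁ p).re, -w p * (k₁ p).re]

/-- If `v 0` and `v 2` are real and `k₂` is not, then `v 2 = k₂ v 0` forces both to vanish; the
other equations determine `v` from `v 1`. -/
theorem HasEqs.mem_realPoints (E : HasEqs U N k₁ k₂ w) {p : Pt} (hp : p ∈ U)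
    (h1 : star (k₁ p) = k₁ p) (h2 : star (k₂ p) ≠ k₂ p) (v : Pt) :
    v ∈ realPoints (N p) ↔ v = v 1 • realVec k₁ w p := by
  have hk : ((k₁ p).re : ℂ) = k₁ p := Complex.conj_eq_iff_re.1 h1
  change toC v ∈ N p ↔ _
  rw [E p hp]
  simp only [toC]
  constructor
  · rintro ⟨a, b, c⟩
    have h0 : (v 0 : ℂ) = 0 := by
      have a' := congrArg star a
      simp only [star_mul', RCLike.star_def, Complex.conj_ofReal] at a'
      have : (star (k₂ p) - k₂ p) * v 0 = 0 := by
        rw [sub_mul, ← a]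
        simp only [RCLike.star_def]
        rw [← a', sub_self]
      exact (mul_eq_zero.1 this).resolve_left (sub_ne_zero.2 h2)
    rw [h0, mul_zero] at a
    rw [← hk] at b
    norm_cast at a b c h0
    ext i
    fin_cases i <;> simp [realVec, a, b, c, h0] <;> ring
  · intro h
    have h0 := congrFun h 0
    have h2 := congrFun h 2
    have h3 := congrFun h 3
    have h4 := congrFun h 4
    simp only [realVec, Pi.smul_apply, smul_eq_mul, Matrix.cons_val, mul_zero] at h0 h2 h3 h4
    rw [h0, h2, h4, h3]
    refine ⟨by simp, by push_cast; rw [hk]; ring, by push_cast; ring⟩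

theorem HasEqs.isAlmostOptical (E : HasEqs U N k₁ k₂ w) (H : NullData U k₁ k₂ w)
    {g : Pt → Matrix (Fin 5) (Fin 5) ℝ} (hN : IsAlmostNull U g N)
    (h1 : ∀ p ∈ U, star (k₁ p) = k₁ p) (h2 : ∀ p ∈ U, star (k₂ p) ≠ k₂ p) :
    IsAlmostOptical U g N (fun p => realPoints (N p)) := by
  have hspan : ∀ p ∈ U, N p ⊓ conjSub (N p) = Submodule.span ℂ {toC (realVec k₁ w p)} := by
    intro p hp
    have hk : ((k₁ p).re : ℂ) = k₁ p := Complex.conj_eq_iff_re.1 (h1 p hp)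
    ext X
    rw [Submodule.mem_span_singleton]
    constructor
    · rintro ⟨hX, hX'⟩
      obtain ⟨a, b, c⟩ := (E p hp X).1 hX
      obtain ⟨a', -, -⟩ := (E.conj p hp X).1 hX'
      have h0 : X 0 = 0 := by
        have : (star (k₂ p) - k₂ p) * X 0 = 0 := by rw [sub_mul, ← a, ← a', sub_self]
        exact (mul_eq_zero.1 this).resolve_left (sub_ne_zero.2 (h2 p hp))
      refine ⟨X 1, ?_⟩
      ext i
      fin_cases i <;> simp [realVec, toC, a, b, c, h0, hk] <;> ring
    · rintro ⟨t, rfl⟩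
      refine ⟨(E p hp _).2 ?_, (E.conj p hp _).2 ?_⟩
      · simp [realVec, toC, hk]
        exact ⟨by ring, by ring⟩
      · have := h1 p hp
        simp only [RCLike.star_def] at this
        simp [realVec, toC, hk, this]
        exact ⟨by ring, by ring⟩
  have hreal : ∀ p ∈ U, Submodule.span ℝ {realVec k₁ w p} = realPoints (N p) := by
    intro p hp
    ext v
    rw [E.mem_realPoints hp (h1 p hp) (h2 p hp), Submodule.mem_span_singleton]
    constructor
    · rintro ⟨t, rfl⟩
      simp [realVec]
    · intro h
      exact ⟨v 1, h.symm⟩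
  have hne : ∀ p, toC (realVec k₁ w p) ≠ 0 := fun p h => by
    simpa [toC, realVec] using congrFun h 1
  have hre : ContDiffOn ℝ ∞ (fun q => (k₁ q).re) U :=
    Complex.reCLM.contDiff.comp_contDiffOn H.smooth₁
  refine ⟨hN, ?_, ?_, ?_, ?_⟩
  · intro p hp
    rw [realIndex, hspan p hp]
    exact finrank_span_singleton (hne p)
  · intro p hp
    refine ⟨U, H.isOpen, hp, subset_rfl, fun _ => realVec k₁ w, ?_, fun q hq => ⟨?_, ?_⟩⟩
    · intro a
      rw [contDiffOn_pi]
      intro i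
      fin_cases i <;> simp [realVec] <;>
        first
          | exact contDiffOn_const
          | exact hre
          | exact (H.smooth_w.mul hre).neg
    · rw [linearIndependent_unique_iff]
      intro h
      simpa [realVec] using congrFun h 1
    · rw [Set.range_const, hreal q hq]
  · intro p hp v hv
    -- A real vector of `N` lies, complexified, in `N ⊆ N^⊥`, hence is null for `g`.
    have := hN.null p hp hv (toC v) hv
    simp only [metricC, toC] at this
    exact_mod_cast this
  · intro p hp
    rw [hspan p hp, ← hreal p hp]
    apply le_antisymm
    · rw [Submodule.span_le]
      rintro _ rfl
      exact Submodule.subset_span ⟨_, Submodule.mem_span_singleton_self _, rfl⟩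
    · rw [complexify, Submodule.span_le]
      rintro _ ⟨v, hv, rfl⟩
      obtain ⟨t, rfl⟩ := Submodule.mem_span_singleton.1 hv
      refine Submodule.mem_span_singleton.2 ⟨(t : ℂ), ?_⟩
      ext i
      simp [toC]

end Distributions

/-! ### Principal roots, the null coframe and its kernels. -/

section Coframe

/-! The principal square root. -/

theorem csqrt_of_nonneg {r : ℝ} (h : 0 ≤ r) : csqrt r = (√r : ℂ) := by
  simp [csqrt, Real.sqrt_eq_zero_of_nonpos (neg_nonpos.2 h)]

theorem csqrt_of_nonpos {r : ℝ} (h : r ≤ 0) : csqrt r = Complex.I * (√(-r) : ℂ) := by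
  simp [csqrt, Real.sqrt_eq_zero_of_nonpos h]

theorem csqrt_sq (r : ℝ) : csqrt r ^ 2 = (r : ℂ) := by
  rcases le_total 0 r with h | h
  · rw [csqrt_of_nonneg h]
    norm_cast
    exact Real.sq_sqrt h
  · rw [csqrt_of_nonpos h, mul_pow, Complex.I_sq]
    norm_cast
    rw [Real.sq_sqrt (neg_nonneg.2 h)]
    simp

theorem csqrt_ne_zero {r : ℝ} (h : r ≠ 0) : csqrt r ≠ 0 := fun e => by
  have := csqrt_sq r
  rw [e] at this
  simp at this
  exact h (by exact_mod_cast this.symm)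

/-- Off zero each of the two real roots is smooth: one is a genuine root, the other is locally the
constant `0`. -/
theorem contDiffAt_csqrt {f : Pt → ℝ} {p : Pt} (hf : ContDiffAt ℝ ∞ f p) (h : f p ≠ 0) :
    ContDiffAt ℝ ∞ (fun q => csqrt (f q)) p := by
  unfold csqrt
  have h1 : ContDiffAt ℝ ∞ (fun q => ((√(f q) : ℝ) : ℂ)) p :=
    Complex.ofRealCLM.contDiff.contDiffAt.comp p (hf.sqrt h)
  have h2 : ContDiffAt ℝ ∞ (fun q => ((√(-f q) : ℝ) : ℂ)) p :=
    Complex.ofRealCLM.contDiff.contDiffAt.comp p (hf.neg.sqrt (neg_ne_zero.2 h))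
  exact h1.add (contDiffAt_const.mul h2)

/-! The null distributions of the black ring, in terms of linear equations. -/

/-- The columns of `M⁻¹` are the basis dual to the rows of `M`, so the span of two of them is the
common kernel of the other three rows. -/
theorem mem_span_inv_cols {M : Matrix (Fin 5) (Fin 5) ℂ} (hM : IsUnit M.det) {a b : Fin 5}
    (hab : a ≠ b) (X : CVec) :
    X ∈ Submodule.span ℂ {(fun i => M⁻¹ i a : CVec), fun i => M⁻¹ i b} ↔
      ∀ c, c ≠ a → c ≠ b → M.mulVec X c = 0 := by
  have hcol : ∀ c, M.mulVec (fun i => M⁻¹ i c) = Pi.single c 1 := by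
    intro c
    ext j
    have := congrFun (congrFun (Matrix.mul_nonsing_inv M hM) j) c
    rw [Matrix.mul_apply] at this
    rw [Matrix.mulVec, dotProduct, this]
    simp [Matrix.one_apply, Pi.single_apply]
  rw [Submodule.mem_span_pair]
  constructor
  · rintro ⟨s, t, rfl⟩ c ha hb
    rw [Matrix.mulVec_add, Matrix.mulVec_smul, Matrix.mulVec_smul, hcol, hcol]
    simp [ha, hb]
  · intro h
    refine ⟨M.mulVec X a, M.mulVec X b, ?_⟩
    have e : M⁻¹.mulVec (M.mulVec X) = X := by
      rw [Matrix.mulVec_mulVec, Matrix.nonsing_inv_mul M hM, Matrix.one_mulVec]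
    ext i
    have ei : ∑ c, M⁻¹ i c * M.mulVec X c = X i := congrFun e i
    generalize M.mulVec X = v at h ei ⊢
    rw [← ei, Finset.sum_eq_add a b hab]
    · simp [mul_comm]
    · rintro c - ⟨hca, hcb⟩
      rw [h c hca hcb, mul_zero]
    · simp
    · simp

variable {R lam nu : ℝ} {p : Pt}

/-- The ratio of the components `X³` and `X¹` on the kernel of `θ¹`. -/
def ringK1 (lam nu : ℝ) (p : Pt) : ℂ := Complex.I * (csqrt (ringF lam (p 1)) / ringG nu (p 1))

/-- The ratio of the components `X²` and `X⁰` on the kernel of `θ²`. -/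
def ringK2 (lam nu : ℝ) (p : Pt) : ℂ := Complex.I * (csqrt (ringF lam (p 0)) / ringG nu (p 0))

/-- The coefficient of `dψ` in `e⁰`. -/
def ringW (R lam nu : ℝ) (p : Pt) : ℝ := R * √(lam * nu) * (1 + p 1)

theorem ringK1_sq (lam nu : ℝ) (p : Pt) :
    ringK1 lam nu p ^ 2 = -((ringF lam (p 1) / ringG nu (p 1) ^ 2 : ℝ) : ℂ) := by
  rw [ringK1, mul_pow, div_pow, csqrt_sq, Complex.I_sq]
  push_cast
  ring

theorem ringK2_sq (lam nu : ℝ) (p : Pt) :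
    ringK2 lam nu p ^ 2 = -((ringF lam (p 0) / ringG nu (p 0) ^ 2 : ℝ) : ℂ) := by
  rw [ringK2, mul_pow, div_pow, csqrt_sq, Complex.I_sq]
  push_cast
  ring

theorem Regular.ringK1_ne_zero (H : Regular lam nu p) : ringK1 lam nu p ≠ 0 :=
  mul_ne_zero Complex.I_ne_zero (div_ne_zero (csqrt_ne_zero H.Fy) (Complex.ofReal_ne_zero.2 H.Gy))

theorem Regular.ringK2_ne_zero (H : Regular lam nu p) : ringK2 lam nu p ≠ 0 :=
  mul_ne_zero Complex.I_ne_zero (div_ne_zero (csqrt_ne_zero H.Fx) (Complex.ofReal_ne_zero.2 H.Gx))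

/-- The kernels of the `1`-forms of the coframe. -/
theorem Regular.coframe_eqs (hR : R ≠ 0) (H : Regular lam nu p) (X : CVec) :
    ((ringCoframe R lam nu p).mulVec X 0 = 0 ↔ X 3 = ringK1 lam nu p * X 1) ∧
    ((ringCoframe R lam nu p).mulVec X 1 = 0 ↔ X 3 = -ringK1 lam nu p * X 1) ∧
    ((ringCoframe R lam nu p).mulVec X 2 = 0 ↔ X 2 = ringK2 lam nu p * X 0) ∧
    ((ringCoframe R lam nu p).mulVec X 3 = 0 ↔ X 2 = -ringK2 lam nu p * X 0) ∧
    ((ringCoframe R lam nu p).mulVec X 4 = 0 ↔ X 4 = -ringW R lam nu p * X 3) := by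
  obtain ⟨h1, h2, h3, h4, h5⟩ := H
  have hxy : (p 0 : ℂ) - p 1 ≠ 0 := by exact_mod_cast h1
  have hR' : (R : ℂ) ≠ 0 := by exact_mod_cast hR
  have hF : (ringF lam (p 1) : ℂ) ≠ 0 := by exact_mod_cast h3
  have h2' : ((√2 : ℝ) : ℂ) ≠ 0 := by norm_num
  have a1 : (R * csqrt (-(ringF lam (p 0) * ringG nu (p 1))) / ((√2 : ℝ) * (p 0 - p 1)) : ℂ) ≠ 0 :=
    div_ne_zero (mul_ne_zero hR' (csqrt_ne_zero (neg_ne_zero.2 (mul_ne_zero h2 h5))))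
      (mul_ne_zero h2' hxy)
  have a2 : (R * ringF lam (p 1) * csqrt (ringG nu (p 0)) /
      ((√2 : ℝ) * (p 0 - p 1) * csqrt (ringF lam (p 0))) : ℂ) ≠ 0 :=
    div_ne_zero (mul_ne_zero (mul_ne_zero hR' hF) (csqrt_ne_zero h4))
      (mul_ne_zero (mul_ne_zero h2' hxy) (csqrt_ne_zero h2))
  have a0 : csqrt (-(ringF lam (p 0) / ringF lam (p 1))) ≠ 0 :=
    csqrt_ne_zero (neg_ne_zero.2 (div_ne_zero h2 h3))
  simp only [Matrix.mulVec, dotProduct, Fin.sum_univ_five, ringCoframe, ringK1, ringK2, ringW]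
  -- Of the prefactors only nonvanishing matters: each row is a nonzero multiple of the asserted
  -- linear equation, using `I² = -1`.
  generalize (R * csqrt (-(ringF lam (p 0) * ringG nu (p 1))) / ((√2 : ℝ) * (p 0 - p 1)) : ℂ) = a₁
    at *
  generalize (R * ringF lam (p 1) * csqrt (ringG nu (p 0)) /
      ((√2 : ℝ) * (p 0 - p 1) * csqrt (ringF lam (p 0))) : ℂ) = a₂ at *
  generalize csqrt (-(ringF lam (p 0) / ringF lam (p 1))) = a₀ at *
  generalize csqrt (ringF lam (p 0)) / ringG nu (p 0) = b₂
  generalize csqrt (ringF lam (p 1)) / ringG nu (p 1) = b₁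
  have hI := Complex.I_sq
  have key : ∀ {c s t : ℂ}, c ≠ 0 → s = c * t → (s = 0 ↔ t = 0) := fun hc e => by
    rw [e, mul_eq_zero, or_iff_right hc]
  refine ⟨?_, ?_, ?_, ?_, ?_⟩
  · rw [← sub_eq_zero (a := X 3)]
    refine key (mul_ne_zero a1 Complex.I_ne_zero) ?_
    simp
    linear_combination (a₁ * b₁ * X 1) * hI
  · rw [← sub_eq_zero (a := X 3)]
    refine key (neg_ne_zero.2 (mul_ne_zero a1 Complex.I_ne_zero)) ?_
    simp
    linear_combination (a₁ * b₁ * X 1) * hI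
  · rw [← sub_eq_zero (a := X 2)]
    refine key (mul_ne_zero a2 Complex.I_ne_zero) ?_
    simp
    linear_combination (a₂ * b₂ * X 0) * hI
  · rw [← sub_eq_zero (a := X 2)]
    refine key (neg_ne_zero.2 (mul_ne_zero a2 Complex.I_ne_zero)) ?_
    simp
    linear_combination (a₂ * b₂ * X 0) * hI
  · rw [← sub_eq_zero (a := X 4)]
    refine key a0 ?_
    simp
    ring

/-- The common kernel of the five forms is zero: `X³ = ± k₁ X¹` for both signs with `k₁ ≠ 0` gives
`X¹ = X³ = 0`, similarly `X⁰ = X² = 0`, and then `X⁴ = 0`. -/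
theorem Regular.isUnit_det_coframe (hR : R ≠ 0) (H : Regular lam nu p) :
    IsUnit (ringCoframe R lam nu p).det := by
  rw [isUnit_iff_ne_zero]
  intro h
  obtain ⟨X, hX, hM⟩ := Matrix.exists_mulVec_eq_zero_iff.2 h
  obtain ⟨e0, e1, e2, e3, e4⟩ := H.coframe_eqs hR X
  have e0 := e0.1 (congrFun hM 0)
  have e1 := e1.1 (congrFun hM 1)
  have e2 := e2.1 (congrFun hM 2)
  have e3 := e3.1 (congrFun hM 3)
  have e4 := e4.1 (congrFun hM 4)
  have h1 : X 1 = 0 := by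
    have : ringK1 lam nu p * X 1 = 0 := by linear_combination (e1 - e0) / 2
    exact (mul_eq_zero.1 this).resolve_left H.ringK1_ne_zero
  have h0 : X 0 = 0 := by
    have : ringK2 lam nu p * X 0 = 0 := by linear_combination (e3 - e2) / 2
    exact (mul_eq_zero.1 this).resolve_left H.ringK2_ne_zero
  apply hX
  ext i
  fin_cases i <;> simp [h0, h1, e0, e2, e4]

variable {U : Set Pt}

/-- The span of `θ̃₁, θ̃₂` is the common kernel of the complementary forms `θ¹, θ², e⁰`. For the
other three structures, exchanging `θ^j` with `θ̃^j` flips the sign of `k_j`. -/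
theorem hasEqs_ringN0 (hR : R ≠ 0) (H : ∀ p ∈ U, Regular lam nu p) :
    HasEqs U (ringN0 R lam nu) (ringK1 lam nu) (ringK2 lam nu) (ringW R lam nu) := by
  intro p hp X
  obtain ⟨e0, e1, e2, e3, e4⟩ := (H p hp).coframe_eqs hR X
  refine (mem_span_inv_cols ((H p hp).isUnit_det_coframe hR) (by decide) X).trans ?_
  rw [← e0, ← e2, ← e4]
  refine ⟨fun h => ⟨h 2 (by decide) (by decide), h 0 (by decide) (by decide),
    h 4 (by decide) (by decide)⟩, fun ⟨h2, h0, h4⟩ => ?_⟩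
  exact forall_fin_five (fun _ _ => h0) (fun h _ => absurd rfl h) (fun _ _ => h2)
    (fun _ h => absurd rfl h) (fun _ _ => h4)

theorem hasEqs_ringN1 (hR : R ≠ 0) (H : ∀ p ∈ U, Regular lam nu p) :
    HasEqs U (ringN1 R lam nu) (fun p => -ringK1 lam nu p) (ringK2 lam nu) (ringW R lam nu) := by
  intro p hp X
  obtain ⟨e0, e1, e2, e3, e4⟩ := (H p hp).coframe_eqs hR X
  refine (mem_span_inv_cols ((H p hp).isUnit_det_coframe hR) (by decide) X).trans ?_
  rw [← e1, ← e2, ← e4]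
  refine ⟨fun h => ⟨h 2 (by decide) (by decide), h 1 (by decide) (by decide),
    h 4 (by decide) (by decide)⟩, fun ⟨h2, h1, h4⟩ => ?_⟩
  exact forall_fin_five (fun h _ => absurd rfl h) (fun _ _ => h1) (fun _ _ => h2)
    (fun _ h => absurd rfl h) (fun _ _ => h4)

theorem hasEqs_ringN2 (hR : R ≠ 0) (H : ∀ p ∈ U, Regular lam nu p) :
    HasEqs U (ringN2 R lam nu) (ringK1 lam nu) (fun p => -ringK2 lam nu p) (ringW R lam nu) := by
  intro p hp X
  obtain ⟨e0, e1, e2, e3, e4⟩ := (H p hp).coframe_eqs hR X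
  refine (mem_span_inv_cols ((H p hp).isUnit_det_coframe hR) (by decide) X).trans ?_
  rw [← e0, ← e3, ← e4]
  refine ⟨fun h => ⟨h 3 (by decide) (by decide), h 0 (by decide) (by decide),
    h 4 (by decide) (by decide)⟩, fun ⟨h3, h0, h4⟩ => ?_⟩
  exact forall_fin_five (fun _ _ => h0) (fun h _ => absurd rfl h)
    (fun _ h => absurd rfl h) (fun _ _ => h3) (fun _ _ => h4)

theorem hasEqs_ringN12 (hR : R ≠ 0) (H : ∀ p ∈ U, Regular lam nu p) :
    HasEqs U (ringN12 R lam nu) (fun p => -ringK1 lam nu p) (fun p => -ringK2 lam nu p)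
      (ringW R lam nu) := by
  intro p hp X
  obtain ⟨e0, e1, e2, e3, e4⟩ := (H p hp).coframe_eqs hR X
  refine (mem_span_inv_cols ((H p hp).isUnit_det_coframe hR) (by decide) X).trans ?_
  rw [← e1, ← e3, ← e4]
  refine ⟨fun h => ⟨h 3 (by decide) (by decide), h 1 (by decide) (by decide),
    h 4 (by decide) (by decide)⟩, fun ⟨h3, h1, h4⟩ => ?_⟩
  exact forall_fin_five (fun h _ => absurd rfl h) (fun _ _ => h1)
    (fun _ h => absurd rfl h) (fun _ _ => h3) (fun _ _ => h4)

/-- The metric in terms of the null coframe. -/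
theorem Regular.metric_eq_coframe (H : Regular lam nu p) (i j : Fin 5) :
    (ringMetric R lam nu p i j : ℂ) =
      ringCoframe R lam nu p 0 i * ringCoframe R lam nu p 1 j +
      ringCoframe R lam nu p 1 i * ringCoframe R lam nu p 0 j +
      ringCoframe R lam nu p 2 i * ringCoframe R lam nu p 3 j +
      ringCoframe R lam nu p 3 i * ringCoframe R lam nu p 2 j +
      ringCoframe R lam nu p 4 i * ringCoframe R lam nu p 4 j := by
  obtain ⟨h1, h2, h3, h4, h5⟩ := H
  have hxy : (p 0 : ℂ) - p 1 ≠ 0 := by exact_mod_cast h1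
  have hFx : (ringF lam (p 0) : ℂ) ≠ 0 := by exact_mod_cast h2
  have hFy : (ringF lam (p 1) : ℂ) ≠ 0 := by exact_mod_cast h3
  have hGx : (ringG nu (p 0) : ℂ) ≠ 0 := by exact_mod_cast h4
  have hGy : (ringG nu (p 1) : ℂ) ≠ 0 := by exact_mod_cast h5
  -- The metric involves the roots only through their squares, so the identity is insensitive to
  -- signs and holds on both regions at once.
  have s0 := csqrt_sq (-(ringF lam (p 0) / ringF lam (p 1)))
  have s1 := csqrt_sq (-(ringF lam (p 0) * ringG nu (p 1)))
  have s2 := csqrt_sq (ringG nu (p 0))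
  have s3 := csqrt_sq (ringF lam (p 0))
  have s4 := csqrt_sq (ringF lam (p 1))
  have s5 : ((√2 : ℝ) : ℂ) ^ 2 = 2 := by norm_cast; simp
  have hI := Complex.I_sq
  have A1 : (R * csqrt (-(ringF lam (p 0) * ringG nu (p 1))) / ((√2 : ℝ) * (p 0 - p 1)) : ℂ) ^ 2
      = -(R ^ 2 / (p 0 - p 1) ^ 2 * ringF lam (p 0) * ringG nu (p 1)) / 2 := by
    rw [div_pow, mul_pow, mul_pow, s1, s5]
    push_cast
    field_simp
  have A2 : (R * ringF lam (p 1) * csqrt (ringG nu (p 0)) /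
      ((√2 : ℝ) * (p 0 - p 1) * csqrt (ringF lam (p 0))) : ℂ) ^ 2
      = R ^ 2 / (p 0 - p 1) ^ 2 * ringF lam (p 1) ^ 2 * ringG nu (p 0) / ringF lam (p 0) / 2 := by
    rw [div_pow, mul_pow, mul_pow, mul_pow, mul_pow, s2, s3, s5]
    field_simp
  have B1 : (csqrt (ringF lam (p 1)) / ringG nu (p 1) : ℂ) ^ 2
      = ringF lam (p 1) / ringG nu (p 1) ^ 2 := by rw [div_pow, s4]
  have B2 : (csqrt (ringF lam (p 0)) / ringG nu (p 0) : ℂ) ^ 2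
      = ringF lam (p 0) / ringG nu (p 0) ^ 2 := by rw [div_pow, s3]
  push_cast at s0
  have E1 : 2 * ((R * csqrt (-(ringF lam (p 0) * ringG nu (p 1))) / ((√2 : ℝ) * (p 0 - p 1)) : ℂ) ^ 2
      * (csqrt (ringF lam (p 1)) / ringG nu (p 1)) ^ 2)
      = -(R ^ 2 / (p 0 - p 1) ^ 2 * ringF lam (p 0) * ringF lam (p 1) / ringG nu (p 1)) := by
    rw [A1, B1]
    field_simp
  have E2 : 2 * ((R * ringF lam (p 1) * csqrt (ringG nu (p 0)) /
      ((√2 : ℝ) * (p 0 - p 1) * csqrt (ringF lam (p 0))) : ℂ) ^ 2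
      * (csqrt (ringF lam (p 0)) / ringG nu (p 0)) ^ 2)
      = R ^ 2 / (p 0 - p 1) ^ 2 * ringF lam (p 1) ^ 2 / ringG nu (p 0) := by
    rw [A2, B2]
    field_simp
  simp only [ringMetric, ringCoframe]
  generalize (R * csqrt (-(ringF lam (p 0) * ringG nu (p 1))) / ((√2 : ℝ) * (p 0 - p 1)) : ℂ) = a₁
    at *
  generalize (R * ringF lam (p 1) * csqrt (ringG nu (p 0)) /
      ((√2 : ℝ) * (p 0 - p 1) * csqrt (ringF lam (p 0))) : ℂ) = a₂ at *
  generalize csqrt (-(ringF lam (p 0) / ringF lam (p 1))) = a₀ at *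
  generalize csqrt (ringF lam (p 0)) / ringG nu (p 0) = b₂ at *
  generalize csqrt (ringF lam (p 1)) / ringG nu (p 1) = b₁ at *
  fin_cases i <;> fin_cases j <;> simp only [Fin.zero_eta, Fin.mk_one, Fin.reduceFinMk,
    Matrix.of_apply, Matrix.cons_val] <;> push_cast <;> first
    | ring1
    | linear_combination -E1
    | linear_combination -E2
    | linear_combination -2 * A2 + 2 * a₂ ^ 2 * hI
    | linear_combination -2 * A1 + 2 * a₁ ^ 2 * hI - (R * (√(lam * nu) : ℝ) * (1 + p 1)) ^ 2 * s0
    | linear_combination -(R * (√(lam * nu) : ℝ) * (1 + p 1)) * s0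
    | linear_combination -s0

end Coframe

/-! ### Signs on the two regions and the resulting geometry. -/

section Regions

variable {R lam nu : ℝ} {p : Pt} {U : Set Pt}

/-! The regions. -/

theorem ringG_pos {ξ : ℝ} (h0 : 0 < nu) (h1 : nu < 1) (h : -1 < ξ) (h' : ξ < 1) :
    0 < ringG nu ξ := mul_pos (by nlinarith) (by nlinarith)

theorem ringF_pos {ξ : ℝ} (h0 : 0 < lam) (h1 : lam < 1) (h' : ξ < 1) : 0 < ringF lam ξ := by
  unfold ringF
  nlinarith

theorem ringG_neg_of_lt {ξ : ℝ} (h0 : 0 < nu) (h : ξ < -1) : ringG nu ξ < 0 :=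
  mul_neg_of_neg_of_pos (by nlinarith) (by nlinarith)

theorem bounds_regionB (hl : 0 < lam) (hl1 : lam < 1) (hn : 0 < nu) (hp : p ∈ regionB lam nu) :
    1 < p 1 ∧ ringF lam (p 1) < 0 ∧ ringG nu (p 1) < 0 := by
  obtain ⟨-, -, h3, h4⟩ := hp
  rw [div_lt_iff₀ hl] at h3
  rw [lt_div_iff₀ hn] at h4
  have h1 : 1 < p 1 := by nlinarith
  refine ⟨h1, ?_, ?_⟩
  · unfold ringF
    linarith
  · exact mul_neg_of_neg_of_pos (by nlinarith) (by linarith)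

theorem regular_regionA (hl : 0 < lam) (hl1 : lam < 1) (hn : 0 < nu) (hn1 : nu < 1) :
    ∀ p ∈ regionA, Regular lam nu p := fun p ⟨h1, h2, h3⟩ =>
  ⟨by linarith, (ringF_pos hl hl1 h2).ne', (ringF_pos hl hl1 (by linarith)).ne',
    (ringG_pos hn hn1 h1 h2).ne', (ringG_neg_of_lt hn h3).ne⟩

theorem regular_regionB (hl : 0 < lam) (hl1 : lam < 1) (hn : 0 < nu) (hn1 : nu < 1) :
    ∀ p ∈ regionB lam nu, Regular lam nu p := fun p hp => by
  obtain ⟨h, hF, hG⟩ := bounds_regionB hl hl1 hn hp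
  obtain ⟨h1, h2, -, -⟩ := hp
  exact ⟨by linarith, (ringF_pos hl hl1 h2).ne', hF.ne, (ringG_pos hn hn1 h1 h2).ne', hG.ne⟩

theorem isOpen_regionA : IsOpen regionA :=
  (isOpen_lt continuous_const (continuous_apply 0)).inter
    ((isOpen_lt (continuous_apply 0) continuous_const).inter
      (isOpen_lt (continuous_apply 1) continuous_const))

theorem isOpen_regionB (lam nu : ℝ) : IsOpen (regionB lam nu) :=
  (isOpen_lt continuous_const (continuous_apply 0)).inter
    ((isOpen_lt (continuous_apply 0) continuous_const).inter
      ((isOpen_lt continuous_const (continuous_apply 1)).inter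
        (isOpen_lt (continuous_apply 1) continuous_const)))

theorem regionA_nonempty : regionA.Nonempty :=
  ⟨![0, -2, 0, 0, 0], by simp [regionA]⟩

theorem regionB_nonempty_iff (hl : 0 < lam) (hn : 0 < nu) :
    (regionB lam nu).Nonempty ↔ nu < lam := by
  rw [← one_div_lt_one_div hl hn]
  constructor
  · rintro ⟨p, -, -, h3, h4⟩
    exact h3.trans h4
  · intro h
    obtain ⟨y, h3, h4⟩ := exists_between h
    exact ⟨![0, y, 0, 0, 0], by norm_num, by norm_num, h3, h4⟩

/-! The metric is Lorentzian. -/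

/-- Taking determinants, `(det P)² det g = -1`. -/
theorem isUnit_det_of_congr {g P : Matrix (Fin 5) (Fin 5) ℝ}
    (h : P.transpose * g * P = Matrix.diagonal ![-1, 1, 1, 1, 1]) : IsUnit P.det := by
  have := congrArg Matrix.det h
  rw [Matrix.det_mul, Matrix.det_diagonal] at this
  simp [Fin.prod_univ_five] at this
  rw [isUnit_iff_ne_zero]
  intro h0
  simp [h0] at this

theorem BlockData.signature_of_f_pos (S : BlockData) (p : Pt) (ha : 0 < S.a p) (hb : 0 < S.b p)
    (hc : 0 < S.c p) (hd : 0 < S.d p) (hf : 0 < S.f p) :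
    ∃ P : Matrix (Fin 5) (Fin 5) ℝ,
      IsUnit P.det ∧ P.transpose * S.metric p * P = Matrix.diagonal ![-1, 1, 1, 1, 1] := by
  have key : ∀ {r : ℝ}, 0 < r → ∃ s : ℝ, s * r * s = 1 := fun {r} hr =>
    ⟨(√r)⁻¹, by
      have := Real.sqrt_pos.2 hr
      field_simp
      exact (Real.sq_sqrt hr.le).symm⟩
  obtain ⟨a, ha⟩ := key ha
  obtain ⟨b, hb⟩ := key hb
  obtain ⟨c, hc⟩ := key hc
  obtain ⟨d, hd⟩ := key hd
  obtain ⟨f, hf⟩ := key hf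
  -- The columns are an orthonormal frame: rescaled `∂_t` (timelike), `∂_x`, `∂_y`, `∂_φ` and `∂_ψ -
  -- w ∂_t`.
  suffices h : (!![0, a, 0, 0, 0; 0, 0, b, 0, 0; 0, 0, 0, c, 0; 0, 0, 0, 0, d;
      f, 0, 0, 0, -(S.w p * d)] : Matrix (Fin 5) (Fin 5) ℝ).transpose * S.metric p *
      !![0, a, 0, 0, 0; 0, 0, b, 0, 0; 0, 0, 0, c, 0; 0, 0, 0, 0, d; f, 0, 0, 0, -(S.w p * d)] =
      Matrix.diagonal ![-1, 1, 1, 1, 1] from ⟨_, isUnit_det_of_congr h, h⟩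
  ext i j
  fin_cases i <;> fin_cases j <;>
    simp [Matrix.mul_apply, Fin.sum_univ_five, metric, ha, hb, hc, hd, hf] <;>
    first
      | ring1
      | exact Or.inl (by ring1)
      | linear_combination hd

theorem BlockData.signature_of_f_neg (S : BlockData) (p : Pt) (ha : 0 < S.a p) (hb : S.b p < 0)
    (hc : 0 < S.c p) (hd : 0 < S.d p) (hf : S.f p < 0) :
    ∃ P : Matrix (Fin 5) (Fin 5) ℝ,
      IsUnit P.det ∧ P.transpose * S.metric p * P = Matrix.diagonal ![-1, 1, 1, 1, 1] := by
  have key : ∀ {r : ℝ}, 0 < r → ∃ s : ℝ, s * r * s = 1 := fun {r} hr =>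
    ⟨(√r)⁻¹, by
      have := Real.sqrt_pos.2 hr
      field_simp
      exact (Real.sq_sqrt hr.le).symm⟩
  obtain ⟨a, ha⟩ := key ha
  obtain ⟨b, hb⟩ := key (neg_pos.2 hb)
  obtain ⟨c, hc⟩ := key hc
  obtain ⟨d, hd⟩ := key hd
  obtain ⟨f, hf⟩ := key (neg_pos.2 hf)
  -- Now `∂_y` is timelike and comes first, and `∂_t` is spacelike; the frame is otherwise the same
  -- up to order.
  suffices h : (!![0, a, 0, 0, 0; b, 0, 0, 0, 0; 0, 0, 0, c, 0; 0, 0, 0, 0, d;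
      0, 0, f, 0, -(S.w p * d)] : Matrix (Fin 5) (Fin 5) ℝ).transpose * S.metric p *
      !![0, a, 0, 0, 0; b, 0, 0, 0, 0; 0, 0, 0, c, 0; 0, 0, 0, 0, d; 0, 0, f, 0, -(S.w p * d)] =
      Matrix.diagonal ![-1, 1, 1, 1, 1] from ⟨_, isUnit_det_of_congr h, h⟩
  ext i j
  fin_cases i <;> fin_cases j <;>
    simp [Matrix.mul_apply, Fin.sum_univ_five, metric, ha, hc, hd] <;>
    first
      | ring1
      | exact Or.inl (by ring1)
      | linear_combination hd
      | linear_combination -hb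
      | linear_combination hf

theorem contDiff_coord (i : Fin 5) : ContDiff ℝ ∞ (fun q : Pt => q i) := contDiff_apply ℝ ℝ i

theorem contDiff_ringF (i : Fin 5) : ContDiff ℝ ∞ (fun q : Pt => ringF lam (q i)) :=
  contDiff_const.sub (contDiff_const.mul (contDiff_coord i))

theorem contDiff_ringG (i : Fin 5) : ContDiff ℝ ∞ (fun q : Pt => ringG nu (q i)) :=
  (contDiff_const.sub ((contDiff_coord i).pow 2)).mul
    (contDiff_const.sub (contDiff_const.mul (contDiff_coord i)))

theorem contDiff_ringW : ContDiff ℝ ∞ (ringW R lam nu) :=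
  contDiff_const.mul (contDiff_const.add (contDiff_coord 1))

theorem Regular.contDiffAt_metric (H : Regular lam nu p) (i j : Fin 5) :
    ContDiffAt ℝ ∞ (fun q => ringMetric R lam nu q i j) p := by
  obtain ⟨h1, h2, h3, h4, h5⟩ := H
  have fx := (contDiff_ringF (lam := lam) 0).contDiffAt (x := p)
  have fy := (contDiff_ringF (lam := lam) 1).contDiffAt (x := p)
  have gx := (contDiff_ringG (nu := nu) 0).contDiffAt (x := p)
  have gy := (contDiff_ringG (nu := nu) 1).contDiffAt (x := p)
  have w := (contDiff_ringW (R := R) (lam := lam) (nu := nu)).contDiffAt (x := p)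
  have W : ContDiffAt ℝ ∞ (fun q : Pt => R ^ 2 / (q 0 - q 1) ^ 2) p :=
    contDiffAt_const.div (((contDiff_coord 0).sub (contDiff_coord 1)).pow 2).contDiffAt
      (pow_ne_zero 2 h1)
  have z : ContDiffAt ℝ ∞ (fun _ : Pt => (0 : ℝ)) p := contDiffAt_const
  have f := fx.div fy h3
  have s34 := (f.mul w).neg
  exact forall_fin_five (P := fun i => ∀ j,
      ContDiffAt ℝ ∞ (fun q => ringMetric R lam nu q i j) p)
    (forall_fin_five ((W.mul (fy.pow 2)).div gx h4) z z z z)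
    (forall_fin_five z ((W.mul fx).mul fy |>.div gy h5).neg z z z)
    (forall_fin_five z z (((W.mul (fy.pow 2)).mul gx).div fx h2) z z)
    (forall_fin_five z z z (((W.mul fx).mul gy).neg.sub (f.mul (w.pow 2))) s34)
    (forall_fin_five z z z s34 f.neg) i j

theorem isSymm_ringMetric (p : Pt) : (ringMetric R lam nu p).IsSymm := by
  ext i j
  fin_cases i <;> fin_cases j <;> rfl

theorem isLorentzian_regionA (hR : 0 < R) (hl : 0 < lam) (hl1 : lam < 1) (hn : 0 < nu)
    (hn1 : nu < 1) : IsLorentzian regionA (ringMetric R lam nu) where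
  smooth i j p hp :=
    ((regular_regionA hl hl1 hn hn1 p hp).contDiffAt_metric i j).contDiffWithinAt
  symm p _ := isSymm_ringMetric p
  signature p hp := by
    have hxy := (regular_regionA hl hl1 hn hn1 p hp).xy
    obtain ⟨h1, h2, h3⟩ := hp
    have fx := ringF_pos hl hl1 h2
    have fy : 0 < ringF lam (p 1) := ringF_pos hl hl1 (by linarith)
    have gx := ringG_pos hn hn1 h1 h2
    have gy := ringG_neg_of_lt hn h3
    have W : 0 < R ^ 2 / (p 0 - p 1) ^ 2 := by positivity
    rw [← ringData_metric]
    apply BlockData.signature_of_f_pos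
    · exact div_pos (mul_pos W (pow_pos fy 2)) gx
    · exact neg_pos.2 (div_neg_of_pos_of_neg (mul_pos (mul_pos W fx) fy) gy)
    · exact div_pos (mul_pos (mul_pos W (pow_pos fy 2)) gx) fx
    · exact neg_pos.2 (mul_neg_of_pos_of_neg (mul_pos W fx) gy)
    · exact div_pos fx fy

theorem isLorentzian_regionB (hR : 0 < R) (hl : 0 < lam) (hl1 : lam < 1) (hn : 0 < nu)
    (hn1 : nu < 1) : IsLorentzian (regionB lam nu) (ringMetric R lam nu) where
  smooth i j p hp :=
    ((regular_regionB hl hl1 hn hn1 p hp).contDiffAt_metric i j).contDiffWithinAt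
  symm p _ := isSymm_ringMetric p
  signature p hp := by
    have hxy := (regular_regionB hl hl1 hn hn1 p hp).xy
    obtain ⟨-, fy, gy⟩ := bounds_regionB hl hl1 hn hp
    obtain ⟨h1, h2, -, -⟩ := hp
    have fx := ringF_pos hl hl1 h2
    have gx := ringG_pos hn hn1 h1 h2
    have W : 0 < R ^ 2 / (p 0 - p 1) ^ 2 := by positivity
    have fy2 : 0 < ringF lam (p 1) ^ 2 := by
      have := fy.ne
      positivity
    rw [← ringData_metric]
    apply BlockData.signature_of_f_neg
    · exact div_pos (mul_pos W fy2) gx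
    · exact neg_neg_of_pos (div_pos_of_neg_of_neg (mul_neg_of_pos_of_neg (mul_pos W fx) fy) gy)
    · exact div_pos (mul_pos (mul_pos W fy2) gx) fx
    · exact neg_pos.2 (mul_neg_of_pos_of_neg (mul_pos W fx) gy)
    · exact div_neg_of_pos_of_neg fx fy

theorem isRicciFlat_ring (hR : R ≠ 0) (h : 0 ≤ lam * nu) (hU : IsOpen U)
    (H : ∀ p ∈ U, Regular lam nu p) : IsRicciFlat (ringMetric R lam nu) U := fun p hp a b =>
  ricci_ring hR h (H p hp) (Regular.secondOrder hR hU H hp) a b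

/-! The null distributions. -/

theorem nullData_ring (hU : IsOpen U) (H : ∀ p ∈ U, Regular lam nu p) :
    NullData U (ringK1 lam nu) (ringK2 lam nu) (ringW R lam nu) where
  isOpen := hU
  smooth₁ p hp := by
    have g : ContDiffAt ℝ ∞ (fun q : Pt => (ringG nu (q 1) : ℂ)) p :=
      (Complex.ofRealCLM.contDiff.comp (contDiff_ringG 1)).contDiffAt
    exact (contDiffAt_const.mul ((contDiffAt_csqrt (contDiff_ringF 1).contDiffAt
      (H p hp).Fy).mul (g.inv (Complex.ofReal_ne_zero.2 (H p hp).Gy)))).contDiffWithinAt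
  smooth₂ p hp := by
    have g : ContDiffAt ℝ ∞ (fun q : Pt => (ringG nu (q 0) : ℂ)) p :=
      (Complex.ofRealCLM.contDiff.comp (contDiff_ringG 0)).contDiffAt
    exact (contDiffAt_const.mul ((contDiffAt_csqrt (contDiff_ringF 0).contDiffAt
      (H p hp).Fx).mul (g.inv (Complex.ofReal_ne_zero.2 (H p hp).Gx)))).contDiffWithinAt
  smooth_w := contDiff_ringW.contDiffOn
  dep₁ q q' h := by simp only [ringK1, h]
  dep₂ q q' h := by simp only [ringK2, h]
  dep_w q q' h := by simp only [ringW, h]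

theorem metricC_block (S : BlockData) (p : Pt) (X Y : CVec) :
    metricC S.metric p X Y = S.a p * X 0 * Y 0 + S.b p * X 1 * Y 1 + S.c p * X 2 * Y 2
      + S.d p * X 3 * Y 3 - S.f p * (X 4 + S.w p * X 3) * (Y 4 + S.w p * Y 3) := by
  simp [metricC, Fin.sum_univ_five, BlockData.metric]
  ring

variable {N : Pt → Submodule ℂ CVec} {k₁ k₂ : Pt → ℂ}

/-- With `a = -c k₂²` and `b = -d k₁²`, pairing with the frame of `N` gives `c k₂ (X² - k₂ X⁰)` and
`d k₁ (X³ - k₁ X¹)`; the component along `e⁰` is unconstrained, since `e⁰` vanishes on `N`.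
Prescribing only the squares of `k₁, k₂` covers all four sign choices. -/
theorem HasEqs.orth (E : HasEqs U N k₁ k₂ (ringW R lam nu)) (hR : R ≠ 0)
    (H : ∀ p ∈ U, Regular lam nu p) (h1 : ∀ p, k₁ p ^ 2 = ringK1 lam nu p ^ 2)
    (h2 : ∀ p, k₂ p ^ 2 = ringK2 lam nu p ^ 2) :
    HasOrthEqs U (orthC (ringMetric R lam nu) N) k₁ k₂ := by
  intro p hp X
  have Hp := H p hp
  have G := Hp.firstOrder hR
  have eb : ((ringData R lam nu).b p : ℂ) = -(ringData R lam nu).d p * k₁ p ^ 2 := by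
    rw [h1, ringK1_sq]
    norm_cast
    have hxy := Hp.xy
    have := Hp.Gy
    simp only [ringData]
    field_simp
  have ea : ((ringData R lam nu).a p : ℂ) = -(ringData R lam nu).c p * k₂ p ^ 2 := by
    rw [h2, ringK2_sq]
    norm_cast
    have hxy := Hp.xy
    have := Hp.Fx
    have := Hp.Gx
    simp only [ringData]
    field_simp
  have n1 : k₁ p ≠ 0 := fun h => Hp.ringK1_ne_zero (by simpa [h] using (h1 p).symm)
  have n2 : k₂ p ≠ 0 := fun h => Hp.ringK2_ne_zero (by simpa [h] using (h2 p).symm)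
  have hc : ((ringData R lam nu).c p : ℂ) ≠ 0 := Complex.ofReal_ne_zero.2 G.c0
  have hd : ((ringData R lam nu).d p : ℂ) ≠ 0 := Complex.ofReal_ne_zero.2 G.d0
  have hw : (ringData R lam nu).w p = ringW R lam nu p := rfl
  change (∀ Y ∈ N p, metricC (ringMetric R lam nu) p X Y = 0) ↔ _
  simp only [← ringData_metric, metricC_block, hw, ea, eb]
  constructor
  · intro h
    have e2 := h ![1, 0, k₂ p, 0, 0] ((E p hp _).2 (by simp))
    have e1 := h ![0, 1, 0, k₁ p, -ringW R lam nu p * k₁ p] ((E p hp _).2 (by simp))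
    simp only [Matrix.cons_val] at e1 e2
    constructor
    · refine sub_eq_zero.1 ((mul_eq_zero.1 (?_ : (ringData R lam nu).c p * k₂ p *
        (X 2 - k₂ p * X 0) = 0)).resolve_left (mul_ne_zero hc n2))
      linear_combination e2
    · refine sub_eq_zero.1 ((mul_eq_zero.1 (?_ : (ringData R lam nu).d p * k₁ p *
        (X 3 - k₁ p * X 1) = 0)).resolve_left (mul_ne_zero hd n1))
      linear_combination e1
  · rintro ⟨e2, e3⟩ Y hY
    obtain ⟨f2, f3, f4⟩ := (E p hp Y).1 hY
    rw [e2, e3, f4, f3, f2]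
    ring

theorem HasEqs.isAlmostNull (E : HasEqs U N k₁ k₂ (ringW R lam nu)) (hR : R ≠ 0)
    (H : ∀ p ∈ U, Regular lam nu p) (h1 : ∀ p, k₁ p ^ 2 = ringK1 lam nu p ^ 2)
    (h2 : ∀ p, k₂ p ^ 2 = ringK2 lam nu p ^ 2) (D : NullData U k₁ k₂ (ringW R lam nu)) :
    IsAlmostNull U (ringMetric R lam nu) N where
  subbundle := E.isSmoothSubbundle D
  null p hp X hX := (E.orth hR H h1 h2 p hp X).2
    ⟨((E p hp X).1 hX).1, ((E p hp X).1 hX).2.1⟩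

/-- The Weyl tensor is not algebraically special. -/
theorem HasEqs.not_weylSpecialAt (E : HasEqs U N k₁ k₂ (ringW R lam nu)) (hR : R ≠ 0)
    (hl : 0 < lam) (hn : 0 < nu) (hU : IsOpen U) (H : ∀ p ∈ U, Regular lam nu p)
    (h1 : ∀ p, k₁ p ^ 2 = ringK1 lam nu p ^ 2) (h2 : ∀ p, k₂ p ^ 2 = ringK2 lam nu p ^ 2)
    (hp : p ∈ U) : ¬ WeylSpecialAt (ringMetric R lam nu) N p := by
  intro h
  have hO := E.orth hR H h1 h2 p hp
  -- The vector `∂_x + k₂ ∂_φ` is in `N`, and `∂_t`, a multiple of `e₀`, is in `N^⊥`; the fourth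
  -- argument is free, and `∂_t` is taken again.
  have := h ![1, 0, k₂ p, 0, 0] ((hO _).2 (by simp)) ![0, 0, 0, 0, 1] ((hO _).2 (by simp))
    ![1, 0, k₂ p, 0, 0] ((E p hp _).2 (by simp)) ![0, 0, 0, 0, 1]
  rw [weylC_ring hR (mul_pos hl hn).le (H p hp) (Regular.secondOrder hR hU H hp) (k₂ p)
    ((h2 p).trans (ringK2_sq lam nu p)), Complex.ofReal_eq_zero] at this
  exact div_ne_zero hl.ne' (mul_ne_zero (H p hp).Fy (H p hp).xy) this

/-! Reality properties of the coefficients. -/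

theorem star_ringK1_of_nonneg (h : 0 ≤ ringF lam (p 1)) :
    star (ringK1 lam nu p) = -ringK1 lam nu p := by
  simp [ringK1, csqrt_of_nonneg h]

theorem star_ringK1_of_nonpos (h : ringF lam (p 1) ≤ 0) :
    star (ringK1 lam nu p) = ringK1 lam nu p := by
  simp [ringK1, csqrt_of_nonpos h]
  ring

theorem star_ringK2_of_nonneg (h : 0 ≤ ringF lam (p 0)) :
    star (ringK2 lam nu p) = -ringK2 lam nu p := by
  simp [ringK2, csqrt_of_nonneg h]

theorem isOptical_ring (hR : R ≠ 0) (H : ∀ p ∈ U, Regular lam nu p)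
    (E : HasEqs U N k₁ k₂ (ringW R lam nu)) (D : NullData U k₁ k₂ (ringW R lam nu))
    (h1 : ∀ p, k₁ p ^ 2 = ringK1 lam nu p ^ 2) (h2 : ∀ p, k₂ p ^ 2 = ringK2 lam nu p ^ 2)
    (r1 : ∀ p ∈ U, star (k₁ p) = k₁ p) (r2 : ∀ p ∈ U, star (k₂ p) ≠ k₂ p) :
    IsOptical U (ringMetric R lam nu) N (fun p => realPoints (N p)) where
  almostOptical := E.isAlmostOptical D (E.isAlmostNull hR H h1 h2 D) r1 r2
  integrable := E.isIntegrable D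
  integrable_orth := (E.orth hR H h1 h2).isIntegrable D

/-- On this region `F(y) < 0 < F(x)`: `k₁` is real and `k₂` imaginary, so conjugation flips only the
sign of `k₂`. -/
theorem optical_regionB (hR : R ≠ 0) (hl : 0 < lam) (hl1 : lam < 1) (hn : 0 < nu) (hn1 : nu < 1) :
    IsOptical (regionB lam nu) (ringMetric R lam nu) (ringN0 R lam nu)
        (fun p => realPoints (ringN0 R lam nu p)) ∧
      IsOptical (regionB lam nu) (ringMetric R lam nu) (ringN1 R lam nu)
        (fun p => realPoints (ringN1 R lam nu p)) ∧
      ∀ p ∈ regionB lam nu,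
        conjSub (ringN1 R lam nu p) = ringN12 R lam nu p ∧
        conjSub (ringN0 R lam nu p) = ringN2 R lam nu p ∧
        ringN0 R lam nu p ≠ ringN1 R lam nu p ∧
        realPoints (ringN0 R lam nu p) ≠ realPoints (ringN1 R lam nu p) := by
  have H := regular_regionB hl hl1 hn hn1
  have hU := isOpen_regionB lam nu
  have E0 := hasEqs_ringN0 hR H
  have E1 := hasEqs_ringN1 hR H
  have D := nullData_ring (R := R) hU H
  have s1 : ∀ p ∈ regionB lam nu, star (ringK1 lam nu p) = ringK1 lam nu p := fun p hp =>
    star_ringK1_of_nonpos (bounds_regionB hl hl1 hn hp).2.1.le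
  have s2 : ∀ p ∈ regionB lam nu, star (ringK2 lam nu p) = -ringK2 lam nu p := fun p hp =>
    star_ringK2_of_nonneg (ringF_pos hl hl1 hp.2.1).le
  have s2' : ∀ p ∈ regionB lam nu, star (ringK2 lam nu p) ≠ ringK2 lam nu p := fun p hp => by
    rw [s2 p hp]
    exact neg_ne_self.2 (H p hp).ringK2_ne_zero
  have s1' : ∀ p ∈ regionB lam nu, star (-ringK1 lam nu p) = -ringK1 lam nu p := fun p hp => by
    rw [star_neg, s1 p hp]
  refine ⟨isOptical_ring hR H E0 D (fun _ => rfl) (fun _ => rfl) s1 s2',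
    isOptical_ring hR H E1 D.neg₁ (fun p => neg_sq _) (fun _ => rfl) s1' s2',
    fun p hp => ⟨E1.conj.eq_of (hasEqs_ringN12 hR H) hp (s1' p hp) (s2 p hp),
      E0.conj.eq_of (hasEqs_ringN2 hR H) hp (s1 p hp) (s2 p hp),
      E0.ne_of E1 hp (Or.inl (neg_ne_self.2 (H p hp).ringK1_ne_zero).symm), fun e => ?_⟩⟩
  -- If the lines agreed, the vector with `y`-component `1` and slope `k₁` would be the one with
  -- slope `-k₁`, forcing `k₁ = 0`.
  have m := (E0.mem_realPoints hp (s1 p hp) (s2' p hp) (realVec (ringK1 lam nu)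
    (ringW R lam nu) p)).2 (by simp [realVec])
  rw [e, E1.mem_realPoints hp (s1' p hp) (s2' p hp)] at m
  have h3 := congrFun m 3
  have hre : ((ringK1 lam nu p).re : ℂ) = ringK1 lam nu p := Complex.conj_eq_iff_re.1 (s1 p hp)
  simp only [realVec, Pi.smul_apply, smul_eq_mul, Matrix.cons_val, Complex.neg_re, one_mul] at h3
  apply (H p hp).ringK1_ne_zero
  rw [← hre, Complex.ofReal_eq_zero]
  linarith

/-- On this region `F(x), F(y) > 0`: `k₁` and `k₂` are both imaginary and nonzero, so conjugation
flips both signs. -/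
theorem cr_regionA (hR : R ≠ 0) (hl : 0 < lam) (hl1 : lam < 1) (hn : 0 < nu) (hn1 : nu < 1) :
    (IsAlmostNull regionA (ringMetric R lam nu) (ringN0 R lam nu) ∧
        IsCRStructure regionA (ringN0 R lam nu) 2 ∧
        IsIntegrable regionA (orthC (ringMetric R lam nu) (ringN0 R lam nu))) ∧
      (IsAlmostNull regionA (ringMetric R lam nu) (ringN1 R lam nu) ∧
        IsCRStructure regionA (ringN1 R lam nu) 2 ∧
        IsIntegrable regionA (orthC (ringMetric R lam nu) (ringN1 R lam nu))) ∧
      ∀ p ∈ regionA,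
        realIndex (ringN0 R lam nu) p = 0 ∧
        realIndex (ringN1 R lam nu) p = 0 ∧
        conjSub (ringN1 R lam nu p) = ringN2 R lam nu p ∧
        conjSub (ringN0 R lam nu p) = ringN12 R lam nu p ∧
        ringN0 R lam nu p ≠ ringN1 R lam nu p ∧
        ringN0 R lam nu p ≠ ringN2 R lam nu p := by
  have H : ∀ p ∈ regionA, Regular lam nu p := regular_regionA hl hl1 hn hn1
  have E0 := hasEqs_ringN0 hR H
  have E1 := hasEqs_ringN1 hR H
  have E2 := hasEqs_ringN2 hR H
  have D := nullData_ring (R := R) isOpen_regionA H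
  have s1 : ∀ p ∈ regionA, star (ringK1 lam nu p) = -ringK1 lam nu p := fun p hp =>
    star_ringK1_of_nonneg (ringF_pos hl hl1 (by linarith [hp.2.2])).le
  have s2 : ∀ p ∈ regionA, star (ringK2 lam nu p) = -ringK2 lam nu p := fun p hp =>
    star_ringK2_of_nonneg (ringF_pos hl hl1 hp.2.1).le
  have n1 : ∀ p ∈ regionA, star (ringK1 lam nu p) ≠ ringK1 lam nu p := fun p hp => by
    rw [s1 p hp]
    exact neg_ne_self.2 (H p hp).ringK1_ne_zero
  have n1' : ∀ p ∈ regionA, star (-ringK1 lam nu p) ≠ -ringK1 lam nu p := fun p hp => by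
    rw [star_neg]
    exact neg_injective.ne (n1 p hp)
  have n2 : ∀ p ∈ regionA, star (ringK2 lam nu p) ≠ ringK2 lam nu p := fun p hp => by
    rw [s2 p hp]
    exact neg_ne_self.2 (H p hp).ringK2_ne_zero
  refine ⟨⟨E0.isAlmostNull hR H (fun _ => rfl) (fun _ => rfl) D, E0.isCRStructure D n1 n2,
      (E0.orth hR H (fun _ => rfl) (fun _ => rfl)).isIntegrable D⟩,
    ⟨E1.isAlmostNull hR H (fun _ => neg_sq _) (fun _ => rfl) D.neg₁,
      E1.isCRStructure D.neg₁ n1' n2,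
      (E1.orth hR H (fun _ => neg_sq _) (fun _ => rfl)).isIntegrable D.neg₁⟩,
    fun p hp => ⟨?_, ?_, E1.conj.eq_of E2 hp ?_ (s2 p hp),
      E0.conj.eq_of (hasEqs_ringN12 hR H) hp (s1 p hp) (s2 p hp),
      E0.ne_of E1 hp (Or.inl (neg_ne_self.2 (H p hp).ringK1_ne_zero).symm),
      E0.ne_of E2 hp (Or.inr (neg_ne_self.2 (H p hp).ringK2_ne_zero).symm)⟩⟩
  · rw [realIndex, E0.inf_conj_eq_bot hp (n1 p hp) (n2 p hp), finrank_bot]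
  · rw [realIndex, E1.inf_conj_eq_bot hp (n1' p hp) (n2 p hp), finrank_bot]
  · rw [star_neg, s1 p hp, neg_neg]

theorem not_weylSpecial_ring (hR : R ≠ 0) (hl : 0 < lam) (hn : 0 < nu) (hU : IsOpen U)
    (H : ∀ p ∈ U, Regular lam nu p) (hp : p ∈ U) :
    ¬ WeylSpecialAt (ringMetric R lam nu) (ringN0 R lam nu) p ∧
    ¬ WeylSpecialAt (ringMetric R lam nu) (ringN1 R lam nu) p ∧
    ¬ WeylSpecialAt (ringMetric R lam nu) (ringN2 R lam nu) p ∧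
    ¬ WeylSpecialAt (ringMetric R lam nu) (ringN12 R lam nu) p :=
  ⟨(hasEqs_ringN0 hR H).not_weylSpecialAt hR hl hn hU H (fun _ => rfl) (fun _ => rfl) hp,
    (hasEqs_ringN1 hR H).not_weylSpecialAt hR hl hn hU H (fun _ => neg_sq _) (fun _ => rfl) hp,
    (hasEqs_ringN2 hR H).not_weylSpecialAt hR hl hn hU H (fun _ => rfl) (fun _ => neg_sq _) hp,
    (hasEqs_ringN12 hR H).not_weylSpecialAt hR hl hn hU H (fun _ => neg_sq _)
      (fun _ => neg_sq _) hp⟩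

/-- The Rho tensor vanishes on an open set, so its derivatives do too and the whole Cotton-York
tensor is zero there. -/
theorem IsRicciFlat.isCottonYorkDegenerate {g : Pt → Matrix (Fin 5) (Fin 5) ℝ} (hU : IsOpen U)
    (h : IsRicciFlat g U) : IsCottonYorkDegenerate U g N := by
  have hrho : ∀ p ∈ U, ∀ a b, rho g a b p = 0 := fun p hp a b => by
    simp [rho, scalarCurv, h p hp]
  intro p hp X _ Y _ Z _
  have hcov : ∀ b c a, covRho g b c a p = 0 := by
    intro b c a
    have : rho g c a =ᶠ[nhds p] fun _ => 0 :=
      Filter.Eventually.mono (hU.mem_nhds hp) fun q hq => hrho q hq c a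
    simp [covRho, hrho p hp, pd, this.fderiv_eq]
  simp [cottonYorkC, cottonYork, hcov]

theorem not_goldbergSachsConverse : ¬ GoldbergSachsConverse := by
  intro h
  -- Any `0 < ν < λ < 1` would do, since that makes the region `B` nonempty; the choice is `λ =
  -- 1/2`, `ν = 1/4`, `R = 1`.
  have hl : (0 : ℝ) < 1 / 2 := by norm_num
  have hn : (0 : ℝ) < 1 / 4 := by norm_num
  have hl1 : (1 / 2 : ℝ) < 1 := by norm_num
  have hn1 : (1 / 4 : ℝ) < 1 := by norm_num
  obtain ⟨p, hp⟩ := (regionB_nonempty_iff hl hn).2 (by norm_num)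
  have hU := isOpen_regionB (1 / 2) (1 / 4)
  have H := regular_regionB hl hl1 hn hn1
  have hric := isRicciFlat_ring one_ne_zero (mul_pos hl hn).le hU H
  exact (not_weylSpecial_ring one_ne_zero hl hn hU H hp).1
    (h _ _ _ _ hU (isLorentzian_regionB one_pos hl hl1 hn hn1) hric
      (hric.isCottonYorkDegenerate hU) (optical_regionB one_ne_zero hl hl1 hn hn1).1 p hp)

end Regions

end BlackRing

end

/-! ### Assembly of the main theorem. -/

theorem mainTheorem6 :
    (∀ R lam nu : ℝ, 0 < R → 0 < lam → lam < 1 → 0 < nu → nu < 1 →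
      -- the regions are open; A is never empty, and B is not empty exactly when `ν < λ`
      (IsOpen BlackRing.regionA ∧ BlackRing.regionA.Nonempty ∧
        IsOpen (BlackRing.regionB lam nu) ∧
        ((BlackRing.regionB lam nu).Nonempty ↔ nu < lam)) ∧
      -- the black ring is a vacuum Lorentzian metric on both regions
      (BlackRing.IsLorentzian BlackRing.regionA (BlackRing.ringMetric R lam nu) ∧
        BlackRing.IsRicciFlat (BlackRing.ringMetric R lam nu) BlackRing.regionA ∧
        BlackRing.IsLorentzian (BlackRing.regionB lam nu) (BlackRing.ringMetric R lam nu) ∧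
        BlackRing.IsRicciFlat (BlackRing.ringMetric R lam nu) (BlackRing.regionB lam nu)) ∧
      -- `g = 2 θ¹ ⊙ θ̃¹ + 2 θ² ⊙ θ̃² + e⁰ ⊗ e⁰`, with a basis of 1-forms
      (∀ p ∈ BlackRing.regionA ∪ BlackRing.regionB lam nu,
        IsUnit (BlackRing.ringCoframe R lam nu p).det ∧
        ∀ i j, (BlackRing.ringMetric R lam nu p i j : ℂ) =
          BlackRing.ringCoframe R lam nu p 0 i * BlackRing.ringCoframe R lam nu p 1 j +
          BlackRing.ringCoframe R lam nu p 1 i * BlackRing.ringCoframe R lam nu p 0 j +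
          BlackRing.ringCoframe R lam nu p 2 i * BlackRing.ringCoframe R lam nu p 3 j +
          BlackRing.ringCoframe R lam nu p 3 i * BlackRing.ringCoframe R lam nu p 2 j +
          BlackRing.ringCoframe R lam nu p 4 i * BlackRing.ringCoframe R lam nu p 4 j) ∧
      -- region B: two distinct optical structures
      (BlackRing.IsOptical (BlackRing.regionB lam nu) (BlackRing.ringMetric R lam nu)
          (BlackRing.ringN0 R lam nu)
          (fun p => BlackRing.realPoints (BlackRing.ringN0 R lam nu p)) ∧
        BlackRing.IsOptical (BlackRing.regionB lam nu) (BlackRing.ringMetric R lam nu)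
          (BlackRing.ringN1 R lam nu)
          (fun p => BlackRing.realPoints (BlackRing.ringN1 R lam nu p)) ∧
        ∀ p ∈ BlackRing.regionB lam nu,
          BlackRing.conjSub (BlackRing.ringN1 R lam nu p) = BlackRing.ringN12 R lam nu p ∧
          BlackRing.conjSub (BlackRing.ringN0 R lam nu p) = BlackRing.ringN2 R lam nu p ∧
          BlackRing.ringN0 R lam nu p ≠ BlackRing.ringN1 R lam nu p ∧
          BlackRing.realPoints (BlackRing.ringN0 R lam nu p) ≠
            BlackRing.realPoints (BlackRing.ringN1 R lam nu p)) ∧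
      -- region A: two distinct integrable null structures of real index 0, i.e. CR structures
      ((BlackRing.IsAlmostNull BlackRing.regionA (BlackRing.ringMetric R lam nu)
            (BlackRing.ringN0 R lam nu) ∧
          BlackRing.IsCRStructure BlackRing.regionA (BlackRing.ringN0 R lam nu) 2 ∧
          BlackRing.IsIntegrable BlackRing.regionA
            (BlackRing.orthC (BlackRing.ringMetric R lam nu) (BlackRing.ringN0 R lam nu))) ∧
        (BlackRing.IsAlmostNull BlackRing.regionA (BlackRing.ringMetric R lam nu)
            (BlackRing.ringN1 R lam nu) ∧
          BlackRing.IsCRStructure BlackRing.regionA (BlackRing.ringN1 R lam nu) 2 ∧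
          BlackRing.IsIntegrable BlackRing.regionA
            (BlackRing.orthC (BlackRing.ringMetric R lam nu) (BlackRing.ringN1 R lam nu))) ∧
        ∀ p ∈ BlackRing.regionA,
          BlackRing.realIndex (BlackRing.ringN0 R lam nu) p = 0 ∧
          BlackRing.realIndex (BlackRing.ringN1 R lam nu) p = 0 ∧
          BlackRing.conjSub (BlackRing.ringN1 R lam nu p) = BlackRing.ringN2 R lam nu p ∧
          BlackRing.conjSub (BlackRing.ringN0 R lam nu p) = BlackRing.ringN12 R lam nu p ∧
          BlackRing.ringN0 R lam nu p ≠ BlackRing.ringN1 R lam nu p ∧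
          BlackRing.ringN0 R lam nu p ≠ BlackRing.ringN2 R lam nu p) ∧
      -- the Weyl tensor is nowhere algebraically special relative to any of the four structures
      (∀ p ∈ BlackRing.regionA ∪ BlackRing.regionB lam nu,
        ¬ BlackRing.WeylSpecialAt (BlackRing.ringMetric R lam nu) (BlackRing.ringN0 R lam nu) p ∧
        ¬ BlackRing.WeylSpecialAt (BlackRing.ringMetric R lam nu) (BlackRing.ringN1 R lam nu) p ∧
        ¬ BlackRing.WeylSpecialAt (BlackRing.ringMetric R lam nu) (BlackRing.ringN2 R lam nu) p ∧
        ¬ BlackRing.WeylSpecialAt (BlackRing.ringMetric R lam nu) (BlackRing.ringN12 R lam nu) p)) ∧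
    ¬ BlackRing.GoldbergSachsConverse := by
  refine ⟨fun R lam nu hR hl hl1 hn hn1 => ?_, BlackRing.not_goldbergSachsConverse⟩
  have hR0 := hR.ne'
  have hA : ∀ p ∈ BlackRing.regionA, BlackRing.Regular lam nu p :=
    BlackRing.regular_regionA hl hl1 hn hn1
  have hB := BlackRing.regular_regionB hl hl1 hn hn1
  have oA := BlackRing.isOpen_regionA
  have oB := BlackRing.isOpen_regionB lam nu
  have h0 := (mul_pos hl hn).le
  refine ⟨⟨oA, BlackRing.regionA_nonempty, oB, BlackRing.regionB_nonempty_iff hl hn⟩,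
    ⟨BlackRing.isLorentzian_regionA hR hl hl1 hn hn1, BlackRing.isRicciFlat_ring hR0 h0 oA hA,
      BlackRing.isLorentzian_regionB hR hl hl1 hn hn1, BlackRing.isRicciFlat_ring hR0 h0 oB hB⟩,
    fun p hp => ?_, BlackRing.optical_regionB hR0 hl hl1 hn hn1,
    BlackRing.cr_regionA hR0 hl hl1 hn hn1, fun p hp => ?_⟩
  · have H : BlackRing.Regular lam nu p := hp.elim (hA p) (hB p)
    exact ⟨H.isUnit_det_coframe hR0, H.metric_eq_coframe⟩
  · exact hp.elim (BlackRing.not_weylSpecial_ring hR0 hl hn oA hA)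
      (BlackRing.not_weylSpecial_ring hR0 hl hn oB hB)
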